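/- Let $d\ge 1$ and $k\ge 0$ be integers, let $\lambda$ be Lebesgue measure on $\mathbb{R}^d$, and let $W^{k,1}(\Omega)$ be the space of real functions $f\in L^1(\Omega)$ whose weak derivatives $D^\alpha f$, $|\alpha|\le k$, all lie in $L^1(\Omega)$, with norm $\|f\|_{W^{k,1}(\Omega)}=\sum_{|\alpha|\le k}\|D^\alpha f\|_{L^1(\Omega)}$ (so $W^{0,1}=L^1$). Let $\Omega\subset\mathbb{R}^d$ be a bounded open set satisfying the cone condition: there are $\rho>0$ and $0<\kappa\le\pi$ such that for every $x\in\Omega$ there is $v\neq 0$ with $\{x\}\cup\{y: 0<|y-x|\le\rho,\ \angle(y-x,v)\le\kappa/2\}\subset\Omega$. Let $\mathcal{F}\subset W^{k,1}(\Omega)$. Consider the statements - (B) there is $M>0$ with $\|f\|_{W^{k,1}(\Omega)}\le M$ for all $f\in\mathcal{F}$; - (B$'$) there is $M>0$ with $\|f\|_{L^1(\Omega)}+\sum_{|\alpha|=k}\|D^\alpha f\|_{L^1(\Omega)}\le M$ for all $f\in\mathcal{F}$; - (EI) there is $\delta:\mathbb{R}_{>0}\to\mathbb{R}_{>0}$ such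 that $\sum_{|\alpha|\le k}\int_A|D^\alpha f|\,d\lambda<\varepsilon$ for all $f\in\mathcal{F}$, all $\varepsilon>0$ and all measurable $A\subset\Omega$ with $\lambda(A)<\delta(\varepsilon)$; - (EI$'$) the same as (EI), with $\sum_{|\alpha|=k}$ in place of $\sum_{|\alpha|\le k}$; - (E$_\infty$) for every $\varepsilon>0$ there is a measurable set $\omega(\varepsilon)\subset\Omega$ of finite measure such that $\sum_{|\alpha|\le k}\int_{\Omega\setminus\omega(\varepsilon)}|D^\alpha f|\,d\lambda<\varepsilon$ for all $f\in\mathcal{F}$ (automatic here, since $\Omega$ is bounded). Then: 1. (B) holds if and only if (B$'$) holds. 2. If (B) holds, then (EI) holds if and only if (EI$'$) holds. 3. (B), (EI$'$) and (E$_\infty$) hold together if and only if $\mathcal{F}$ is relatively weakly compact in $W^{k,1}(\Omega)$, i.e. its closure in the weak topology of $W^{k,1}(\Omega)$ is weakly compact. -/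

import Mathlib

open MeasureTheory TopologicalSpace
open scoped ContDiff

noncomputable section

namespace Sobolev

/-- The finite set of multi-indices `α ∈ ℕ^d` of length `|α| = ∑ i, α i ≤ k`. -/
def multiIndexLE (d k : ℕ) : Finset (Fin d → ℕ) :=
  (Fintype.piFinset fun _ => Finset.range (k + 1)).filter fun α => ∑ i, α i ≤ k

/-- The finite set of multi-indices `α ∈ ℕ^d` of length `|α| = ∑ i, α i = k`. -/
def multiIndexEQ (d k : ℕ) : Finset (Fin d → ℕ) :=
  (multiIndexLE d k).filter fun α => ∑ i, α i = k

theorem mem_multiIndexLE {d k : ℕ} {α : Fin d → ℕ} :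
    α ∈ multiIndexLE d k ↔ ∑ i, α i ≤ k := by
  simp only [multiIndexLE, Finset.mem_filter, Fintype.mem_piFinset, Finset.mem_range,
    and_iff_right_iff_imp]
  intro h i
  have := Finset.single_le_sum (f := α) (fun j _ => Nat.zero_le _) (Finset.mem_univ i)
  omega

theorem mem_multiIndexEQ {d k : ℕ} {α : Fin d → ℕ} :
    α ∈ multiIndexEQ d k ↔ ∑ i, α i = k := by
  simp only [multiIndexEQ, Finset.mem_filter, mem_multiIndexLE, and_iff_right_iff_imp]
  exact fun h => h.le

/-- The classical partial derivative `∂φ/∂x_i`. -/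
def pderiv {d : ℕ} (i : Fin d) (φ : EuclideanSpace ℝ (Fin d) → ℝ) :
    EuclideanSpace ℝ (Fin d) → ℝ :=
  fun x => fderiv ℝ φ x (EuclideanSpace.single i 1)

/-- The classical derivative `∂₁^{α₁} ∂₂^{α₂} ⋯ ∂_d^{α_d} φ`. -/
def mderiv {d : ℕ} (α : Fin d → ℕ) (φ : EuclideanSpace ℝ (Fin d) → ℝ) :
    EuclideanSpace ℝ (Fin d) → ℝ :=
  (List.ofFn fun i => (pderiv i)^[α i]).foldr (fun T ψ => T ψ) φ

variable {d : ℕ}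

theorem pderiv_smooth (i : Fin d) {φ : EuclideanSpace ℝ (Fin d) → ℝ}
    (h : ContDiff ℝ ∞ φ ∧ HasCompactSupport φ) :
    ContDiff ℝ ∞ (pderiv i φ) ∧ HasCompactSupport (pderiv i φ) := by
  refine ⟨?_, h.2.fderiv_apply (𝕜 := ℝ) _⟩
  exact (h.1.fderiv_right (m := ∞) (by simp)).clm_apply contDiff_const

theorem mderiv_smooth (α : Fin d → ℕ) {φ : EuclideanSpace ℝ (Fin d) → ℝ}
    (h : ContDiff ℝ ∞ φ ∧ HasCompactSupport φ) :
    ContDiff ℝ ∞ (mderiv α φ) ∧ HasCompactSupport (mderiv α φ) := by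
  have key : ∀ l : List ((EuclideanSpace ℝ (Fin d) → ℝ) → EuclideanSpace ℝ (Fin d) → ℝ),
      (∀ T ∈ l, ∀ ψ : EuclideanSpace ℝ (Fin d) → ℝ, (ContDiff ℝ ∞ ψ ∧ HasCompactSupport ψ) →
        ContDiff ℝ ∞ (T ψ) ∧ HasCompactSupport (T ψ)) →
      ContDiff ℝ ∞ (l.foldr (fun T ψ => T ψ) φ) ∧
        HasCompactSupport (l.foldr (fun T ψ => T ψ) φ) := by
    intro l
    induction l with
    | nil => intro _; exact h
    | cons T l ih =>
      intro hl
      exact hl T (by simp) _ (ih fun S hS => hl S (by simp [hS]))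
  refine key _ ?_
  intro T hT ψ hψ
  obtain ⟨i, rfl⟩ := (List.mem_ofFn' _ _).1 hT
  change ContDiff ℝ ∞ ((pderiv i)^[α i] ψ) ∧ HasCompactSupport ((pderiv i)^[α i] ψ)
  generalize α i = n
  induction n with
  | zero => exact hψ
  | succ n ih =>
    rw [Function.iterate_succ_apply']
    exact pderiv_smooth i ih

/-- The real Lebesgue space `L¹(Ω)`. -/
abbrev L1 (Ω : Opens (EuclideanSpace ℝ (Fin d))) : Type :=
  Lp ℝ 1 ((volume : Measure (EuclideanSpace ℝ (Fin d))).restrict (Ω : Set _))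

/-- `g` is the weak derivative `D^α f` on `Ω`, tested against `φ ∈ C_c^∞(Ω)`. -/
def IsWeakDeriv (Ω : Opens (EuclideanSpace ℝ (Fin d))) (α : Fin d → ℕ) (f g : L1 Ω) : Prop :=
  ∀ φ : EuclideanSpace ℝ (Fin d) → ℝ, ContDiff ℝ ∞ φ → HasCompactSupport φ →
    tsupport φ ⊆ Ω →
    ∫ x in (Ω : Set (EuclideanSpace ℝ (Fin d))), f x * mderiv α φ x =
      (-1) ^ (∑ i, α i) * ∫ x in (Ω : Set (EuclideanSpace ℝ (Fin d))), g x * φ x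

variable {Ω : Opens (EuclideanSpace ℝ (Fin d))} {α : Fin d → ℕ}

theorem integrable_mul_test (f : L1 Ω) {φ : EuclideanSpace ℝ (Fin d) → ℝ}
    (h : ContDiff ℝ ∞ φ ∧ HasCompactSupport φ) :
    Integrable (fun x => f x * φ x) (volume.restrict (Ω : Set (EuclideanSpace ℝ (Fin d)))) := by
  obtain ⟨C, hC⟩ := h.1.continuous.bounded_above_of_compact_support h.2
  exact (L1.integrable_coeFn f).mul_bdd (c := C) h.1.continuous.aestronglyMeasurable
    (Filter.Eventually.of_forall hC)

theorem IsWeakDeriv.add {f g f' g' : L1 Ω} (h : IsWeakDeriv Ω α f g)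
    (h' : IsWeakDeriv Ω α f' g') : IsWeakDeriv Ω α (f + f') (g + g') := by
  intro φ h1 h2 h3
  have e1 : ∫ x in (Ω : Set (EuclideanSpace ℝ (Fin d))), (f + f') x * mderiv α φ x =
      ∫ x in (Ω : Set (EuclideanSpace ℝ (Fin d))),
        (f x * mderiv α φ x + f' x * mderiv α φ x) := by
    refine integral_congr_ae ?_
    filter_upwards [Lp.coeFn_add f f'] with x hx
    rw [hx, Pi.add_apply, add_mul]
  have e2 : ∫ x in (Ω : Set (EuclideanSpace ℝ (Fin d))), (g + g') x * φ x =
      ∫ x in (Ω : Set (EuclideanSpace ℝ (Fin d))), (g x * φ x + g' x * φ x) := by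
    refine integral_congr_ae ?_
    filter_upwards [Lp.coeFn_add g g'] with x hx
    rw [hx, Pi.add_apply, add_mul]
  rw [e1, e2, integral_add (integrable_mul_test f (mderiv_smooth α ⟨h1, h2⟩))
    (integrable_mul_test f' (mderiv_smooth α ⟨h1, h2⟩)),
    integral_add (integrable_mul_test g ⟨h1, h2⟩) (integrable_mul_test g' ⟨h1, h2⟩),
    h φ h1 h2 h3, h' φ h1 h2 h3, mul_add]

theorem IsWeakDeriv.smul (c : ℝ) {f g : L1 Ω} (h : IsWeakDeriv Ω α f g) :
    IsWeakDeriv Ω α (c • f) (c • g) := by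
  intro φ h1 h2 h3
  have e1 : ∫ x in (Ω : Set (EuclideanSpace ℝ (Fin d))), (c • f) x * mderiv α φ x =
      ∫ x in (Ω : Set (EuclideanSpace ℝ (Fin d))), c * (f x * mderiv α φ x) := by
    refine integral_congr_ae ?_
    filter_upwards [Lp.coeFn_smul c f] with x hx
    rw [hx, Pi.smul_apply, smul_eq_mul, mul_assoc]
  have e2 : ∫ x in (Ω : Set (EuclideanSpace ℝ (Fin d))), (c • g) x * φ x =
      ∫ x in (Ω : Set (EuclideanSpace ℝ (Fin d))), c * (g x * φ x) := by
    refine integral_congr_ae ?_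
    filter_upwards [Lp.coeFn_smul c g] with x hx
    rw [hx, Pi.smul_apply, smul_eq_mul, mul_assoc]
  rw [e1, e2, integral_const_mul, integral_const_mul, h φ h1 h2 h3]
  ring

theorem IsWeakDeriv.zero : IsWeakDeriv Ω α 0 0 := by
  intro φ _ _ _
  have e (ψ : EuclideanSpace ℝ (Fin d) → ℝ) :
      ∫ x in (Ω : Set (EuclideanSpace ℝ (Fin d))), (0 : L1 Ω) x * ψ x = 0 := by
    refine integral_eq_zero_of_ae ?_
    filter_upwards [Lp.coeFn_zero ℝ 1 (volume.restrict (Ω : Set (EuclideanSpace ℝ (Fin d))))]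
      with x hx
    rw [hx]; simp
  rw [e, e, mul_zero]

/-- Weak derivatives are unique. -/
theorem IsWeakDeriv.unique {f g g' : L1 Ω} (h : IsWeakDeriv Ω α f g)
    (h' : IsWeakDeriv Ω α f g') : g = g' := by
  have hi : Integrable (fun x => g x - g' x)
      (volume.restrict (Ω : Set (EuclideanSpace ℝ (Fin d)))) :=
    (L1.integrable_coeFn g).sub (L1.integrable_coeFn g')
  have key := Ω.isOpen.ae_eq_zero_of_integral_contDiff_smul_eq_zero
    (μ := (volume : Measure (EuclideanSpace ℝ (Fin d)))) (f := fun x => g x - g' x)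
    (IntegrableOn.locallyIntegrableOn hi) ?_
  · apply Lp.ext
    rw [Filter.EventuallyEq, ae_restrict_iff' Ω.isOpen.measurableSet]
    filter_upwards [key] with x hx hxΩ
    exact sub_eq_zero.1 (hx hxΩ)
  · intro φ h1 h2 h3
    have e := (h φ h1 h2 h3).symm.trans (h' φ h1 h2 h3)
    have e' := mul_left_cancel₀ (pow_ne_zero _ (by norm_num)) e
    rw [← setIntegral_eq_integral_of_forall_compl_eq_zero
      (s := (Ω : Set (EuclideanSpace ℝ (Fin d))))]
    · have : ∀ x, φ x • (g x - g' x) = g x * φ x - g' x * φ x := by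
        intro x; rw [smul_eq_mul]; ring
      simp_rw [this]
      rw [integral_sub (integrable_mul_test g ⟨h1, h2⟩) (integrable_mul_test g' ⟨h1, h2⟩), e',
        sub_self]
    · intro x hx
      rw [image_eq_zero_of_notMem_tsupport fun hx' => hx (h3 hx'), zero_smul]

theorem isWeakDeriv_zero_self (f : L1 Ω) : IsWeakDeriv Ω 0 f f := by
  intro φ _ _ _
  have key : mderiv (0 : Fin d → ℕ) φ = φ := by
    unfold mderiv
    simp only [Pi.zero_apply, Function.iterate_zero]
    rw [List.ofFn_const]
    have aux : ∀ n : ℕ, List.foldr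
        (fun (T : (EuclideanSpace ℝ (Fin d) → ℝ) → EuclideanSpace ℝ (Fin d) → ℝ) ψ => T ψ) φ
        (List.replicate n id) = φ := by
      intro n
      induction n with
      | zero => rfl
      | succ n ih => rw [List.replicate_succ, List.foldr_cons, ih]; rfl
    exact aux d
  simp [key]

open scoped Classical in
/-- The weak derivative `D^α f ∈ L¹(Ω)` of `f ∈ L¹(Ω)` (`0` if there is none). -/
def weakDeriv (Ω : Opens (EuclideanSpace ℝ (Fin d))) (α : Fin d → ℕ) (f : L1 Ω) : L1 Ω :=
  if h : ∃ g, IsWeakDeriv Ω α f g then h.choose else 0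

theorem IsWeakDeriv.weakDeriv_eq {f g : L1 Ω} (h : IsWeakDeriv Ω α f g) :
    weakDeriv Ω α f = g := by
  have h' : ∃ g, IsWeakDeriv Ω α f g := ⟨g, h⟩
  rw [weakDeriv, dif_pos h']
  exact h'.choose_spec.unique h

/-- The functions in `L¹(Ω)` all of whose weak derivatives of order at most `k` exist in
`L¹(Ω)`. -/
def sobolevSubmodule (Ω : Opens (EuclideanSpace ℝ (Fin d))) (k : ℕ) :
    Submodule ℝ (L1 Ω) where
  carrier := {f | ∀ α : Fin d → ℕ, ∑ i, α i ≤ k → ∃ g, IsWeakDeriv Ω α f g}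
  add_mem' := by
    intro f f' h h' α hα
    obtain ⟨g, hg⟩ := h α hα
    obtain ⟨g', hg'⟩ := h' α hα
    exact ⟨_, hg.add hg'⟩
  zero_mem' := fun _ _ => ⟨0, IsWeakDeriv.zero⟩
  smul_mem' := by
    intro c f h α hα
    obtain ⟨g, hg⟩ := h α hα
    exact ⟨_, hg.smul c⟩

/-- The Sobolev space `W^{k,1}(Ω)`. It is a copy of `sobolevSubmodule Ω k`, because it carries
its own norm `∑_{|α| ≤ k} ‖D^α f‖_{L¹(Ω)}`, not the one of `L¹(Ω)`. -/
def SobolevSpace (Ω : Opens (EuclideanSpace ℝ (Fin d))) (k : ℕ) : Type :=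
  ↥(sobolevSubmodule Ω k)

namespace SobolevSpace

variable {k : ℕ}

instance : AddCommGroup (SobolevSpace Ω k) :=
  inferInstanceAs (AddCommGroup ↥(sobolevSubmodule Ω k))

instance : Module ℝ (SobolevSpace Ω k) :=
  inferInstanceAs (Module ℝ ↥(sobolevSubmodule Ω k))

/-- `f ∈ W^{k,1}(Ω)` as an element of `L¹(Ω)`. -/
def toL1 (f : SobolevSpace Ω k) : L1 Ω := Subtype.val f

/-- The weak derivative `D^α f` of `f ∈ W^{k,1}(Ω)`. -/
def D (α : Fin d → ℕ) (f : SobolevSpace Ω k) : L1 Ω := weakDeriv Ω α f.toL1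

theorem isWeakDeriv_D (hα : ∑ i, α i ≤ k) (f : SobolevSpace Ω k) :
    IsWeakDeriv Ω α f.toL1 (D α f) := by
  obtain ⟨g, hg⟩ : ∃ g, IsWeakDeriv Ω α f.toL1 g := f.2 α hα
  rw [D, hg.weakDeriv_eq]
  exact hg

theorem D_zero_index (f : SobolevSpace Ω k) : D 0 f = f.toL1 :=
  (isWeakDeriv_zero_self f.toL1).weakDeriv_eq

theorem D_add (hα : ∑ i, α i ≤ k) (f g : SobolevSpace Ω k) : D α (f + g) = D α f + D α g :=
  ((isWeakDeriv_D hα f).add (isWeakDeriv_D hα g)).weakDeriv_eq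

theorem D_smul (hα : ∑ i, α i ≤ k) (c : ℝ) (f : SobolevSpace Ω k) : D α (c • f) = c • D α f :=
  ((isWeakDeriv_D hα f).smul c).weakDeriv_eq

/-- The norm of `W^{k,1}(Ω)`. -/
def sobolevNorm (f : SobolevSpace Ω k) : ℝ := ∑ α ∈ multiIndexLE d k, ‖D α f‖

theorem sobolevNorm_smul (c : ℝ) (f : SobolevSpace Ω k) :
    sobolevNorm (c • f) = |c| * sobolevNorm f := by
  rw [sobolevNorm, sobolevNorm, Finset.mul_sum]
  refine Finset.sum_congr rfl fun α hα => ?_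
  rw [D_smul (mem_multiIndexLE.1 hα), norm_smul, Real.norm_eq_abs]

instance : NormedAddCommGroup (SobolevSpace Ω k) :=
  AddGroupNorm.toNormedAddCommGroup
    { toFun := sobolevNorm
      map_zero' := by
        have := sobolevNorm_smul (0 : ℝ) (0 : SobolevSpace Ω k)
        simpa using this
      add_le' := by
        intro f g
        rw [sobolevNorm, sobolevNorm, sobolevNorm, ← Finset.sum_add_distrib]
        refine Finset.sum_le_sum fun α hα => ?_
        rw [D_add (mem_multiIndexLE.1 hα)]
        exact norm_add_le _ _
      neg' := by
        intro f
        have := sobolevNorm_smul (-1 : ℝ) f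
        simpa using this
      eq_zero_of_map_eq_zero' := by
        intro f hf
        have h0 : (0 : Fin d → ℕ) ∈ multiIndexLE d k := mem_multiIndexLE.2 (by simp)
        have h1 := (Finset.sum_eq_zero_iff_of_nonneg fun α _ => norm_nonneg (D α f)).1 hf 0 h0
        rw [D_zero_index, norm_eq_zero] at h1
        exact Subtype.ext h1 }

theorem norm_def (f : SobolevSpace Ω k) : ‖f‖ = ∑ α ∈ multiIndexLE d k, ‖D α f‖ := rfl

instance : NormedSpace ℝ (SobolevSpace Ω k) where
  norm_smul_le c f := (sobolevNorm_smul c f).le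

end SobolevSpace

/-- The finite cone of height `ρ`, axis direction `v` and aperture angle `κ` with vertex `x`. -/
def finiteCone (x v : EuclideanSpace ℝ (Fin d)) (ρ κ : ℝ) : Set (EuclideanSpace ℝ (Fin d)) :=
  {y | y = x ∨
    (0 < ‖y - x‖ ∧ ‖y - x‖ ≤ ρ ∧ InnerProductGeometry.angle (y - x) v ≤ κ / 2)}

/-- The cone condition: every point of `Ω` is the vertex of a finite cone that is contained in
`Ω` and congruent to one fixed finite cone, i.e. has a prescribed height `ρ` and a prescribed
aperture `κ`. -/
def ConeCondition (Ω : Set (EuclideanSpace ℝ (Fin d))) : Prop :=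
  ∃ ρ κ : ℝ, 0 < ρ ∧ 0 < κ ∧ κ ≤ Real.pi ∧
    ∀ x ∈ Ω, ∃ v : EuclideanSpace ℝ (Fin d), v ≠ 0 ∧ finiteCone x v ρ κ ⊆ Ω

section Families

variable {k : ℕ}

/-- Boundedness in `W^{k,1}(Ω)`. -/
def BoundedFamily (F : Set (SobolevSpace Ω k)) : Prop :=
  ∃ M : ℝ, 0 < M ∧ ∀ f ∈ F, ‖f‖ ≤ M

/-- Boundedness in `L¹(Ω)` of the functions and of their derivatives of order `k`. -/
def BoundedZeroTop (F : Set (SobolevSpace Ω k)) : Prop :=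
  ∃ M : ℝ, 0 < M ∧ ∀ f ∈ F, ‖f.toL1‖ + ∑ α ∈ multiIndexEQ d k, ‖f.D α‖ ≤ M

/-- Equi-integrability of the derivatives `D^α f`, `α ∈ I`, `f ∈ F`. -/
def EquiIntegrableOn (I : Finset (Fin d → ℕ)) (F : Set (SobolevSpace Ω k)) : Prop :=
  ∃ δ : ℝ → ℝ, (∀ ε > 0, 0 < δ ε) ∧
    ∀ f ∈ F, ∀ ε > 0, ∀ A : Set (EuclideanSpace ℝ (Fin d)), A ⊆ Ω →
      NullMeasurableSet A volume → volume A < ENNReal.ofReal (δ ε) →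
      ∑ α ∈ I, ∫ x in A, |f.D α x| < ε

/-- Equi-integrability of all derivatives of order at most `k`. -/
def EquiIntegrable (F : Set (SobolevSpace Ω k)) : Prop :=
  EquiIntegrableOn (multiIndexLE d k) F

/-- Equi-integrability of the derivatives of order exactly `k`. -/
def EquiIntegrableTop (F : Set (SobolevSpace Ω k)) : Prop :=
  EquiIntegrableOn (multiIndexEQ d k) F

/-- Equi-integrability at infinity. -/
def EquiIntegrableAtInfinity (F : Set (SobolevSpace Ω k)) : Prop :=
  ∃ S : ℝ → Set (EuclideanSpace ℝ (Fin d)),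
    (∀ ε > 0, S ε ⊆ Ω ∧ NullMeasurableSet (S ε) volume ∧ volume (S ε) < ⊤) ∧
    ∀ f ∈ F, ∀ ε > 0,
      ∑ α ∈ multiIndexLE d k, ∫ x in (Ω : Set (EuclideanSpace ℝ (Fin d))) \ S ε, |f.D α x| < ε

/-- Relative compactness for the weak topology of `W^{k,1}(Ω)`. -/
def RelativelyWeaklyCompact (F : Set (SobolevSpace Ω k)) : Prop :=
  IsCompact (closure (toWeakSpace ℝ (SobolevSpace Ω k) '' F))

end Families

end Sobolev

end

/-! The proof combines two independent mechanisms.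

The cone condition controls the derivatives of non-maximal order. By compactness of the unit sphere
there are finitely many vectors w and one radius η such that every x in Ω sees, inside Ω, all
segments from x to the points of the ball of radius η about x + w, for one of these w
(`exists_finite_directions`). Along such segments the fundamental theorem of calculus holds for weak
derivatives (`ae_translate_sub_eq`). Used once and averaged over a ball of endpoints of size h, it
bounds ∫_A |u| by C_h λ(A) ‖u‖₁ + C h ‖∇u‖₁ (`mul_lintegral_core_le`). Fixing h first and λ(A)
afterwards shows that in a bounded family all derivatives of order below k are automatically
equi-integrable, which is the content of statement 2. Used to second order, it gives h ‖∇u‖₁ ≤ C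
(‖u‖₁ + h² ‖∇²u‖₁) (`mul_lintegral_grad_core_le`). Iterating this over the orders of differentiation
bounds every intermediate order by the orders 0 and k, which is statement 1.

Weak compactness is the Dunford–Pettis theorem for L¹ of a finite measure, transferred to the
Sobolev space. Truncating an equi-integrable family at a fixed height moves it, up to ε, into the
image of a ball of L², which is weakly compact; hence its weak-star closure in the bidual does not
leave L¹. Weak derivatives are defined by linear identities, which survive such limits, and every
functional on W^{k,1} is a sum of L¹ functionals of the derivatives; so the bidual closure of the
family stays in W^{k,1} (`closure_subset_range_of_derivs`). Together with boundedness this gives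
relative weak compactness. Conversely, weak compactness gives boundedness by Banach–Steinhaus, and
equi-integrability by a Baire category argument in the style of Vitali–Hahn–Saks
(`exists_forall_ge_setIntegral_abs_le`). Equi-integrability at infinity holds with ω = Ω. -/

section

open Filter Topology
open scoped Pointwise

/-! ### Weak compactness and the bidual -/

section WeakCompactness

variable {E : Type*} [NormedAddCommGroup E] [NormedSpace ℝ E]

theorem mem_range_of_forall_exists_norm_sub_le [CompleteSpace E] {F : Type*}
    [NormedAddCommGroup F] [NormedSpace ℝ F] (J : E →ₗᵢ[ℝ] F) {y : F}
    (h : ∀ ε > 0, ∃ x, ‖y - J x‖ ≤ ε) : ∃ x, J x = y := by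
  have hcl : IsClosed (Set.range J) := J.isometry.isClosedEmbedding.isClosed_range
  change y ∈ Set.range J
  rw [← hcl.closure_eq, Metric.mem_closure_iff]
  intro ε hε
  obtain ⟨x, hx⟩ := h (ε / 2) (half_pos hε)
  refine ⟨_, ⟨x, rfl⟩, ?_⟩
  rw [dist_eq_norm]
  linarith

/-- If a set is, up to arbitrarily small norm errors, contained in weakly compact sets, then its
weak-star closure in the bidual consists of elements of the space. -/
theorem closure_image_inclusionInDoubleDualWeak_subset_range [CompleteSpace E] {S : Set E}
    (h : ∀ ε > 0, ∃ K : Set (WeakSpace ℝ E), IsCompact K ∧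
      ∀ f ∈ S, ∃ g : E, toWeakSpace ℝ E g ∈ K ∧ ‖f - g‖ ≤ ε) :
    closure (NormedSpace.inclusionInDoubleDualWeak ℝ E '' (toWeakSpace ℝ E '' S)) ⊆
      Set.range (NormedSpace.inclusionInDoubleDualWeak ℝ E) := by
  intro ξ hξ
  have hJ (x : WeakSpace ℝ E) (l : StrongDual ℝ E) :
    NormedSpace.inclusionInDoubleDualWeak ℝ E x l = l ((toWeakSpace ℝ E).symm x) := rfl
  have key : ∀ ε > 0, ∃ x : E, ∀ l : StrongDual ℝ E, |ξ l - l x| ≤ ε * ‖l‖ := by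
    intro ε hε
    obtain ⟨K, hK, hS⟩ := h ε hε
    -- The ball is weak-star compact by Banach–Alaoglu, so the sum is compact, hence closed, and
    -- contains the whole closure. Thus ξ lies within ε of the canonical copy of E for every ε, and
    -- that copy is norm closed.
    have hc : IsCompact ((NormedSpace.inclusionInDoubleDualWeak ℝ E '' K) +
        (WeakDual.toStrongDual ⁻¹' Metric.closedBall (0 : StrongDual ℝ (StrongDual ℝ E)) ε)) :=
      (hK.image (NormedSpace.inclusionInDoubleDualWeak ℝ E).continuous).add
        (WeakDual.isCompact_closedBall _ _)
    have hsub : closure (NormedSpace.inclusionInDoubleDualWeak ℝ E '' (toWeakSpace ℝ E '' S)) ⊆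
        _ := closure_minimal ?_ hc.isClosed
    · obtain ⟨_, ⟨x, hx, rfl⟩, b, hb, rfl⟩ := hsub hξ
      refine ⟨(toWeakSpace ℝ E).symm x, fun l => ?_⟩
      have hb' : ‖(WeakDual.toStrongDual b : StrongDual ℝ (StrongDual ℝ E))‖ ≤ ε :=
        (mem_closedBall_zero_iff (E := StrongDual ℝ (StrongDual ℝ E))).1 hb
      have e : (NormedSpace.inclusionInDoubleDualWeak ℝ E x + b) l - l ((toWeakSpace ℝ E).symm x)
          = b l := by
        rw [← hJ]
        exact add_sub_cancel_left _ _
      change |(NormedSpace.inclusionInDoubleDualWeak ℝ E x + b) l - _| ≤ _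
      rw [e]
      exact ContinuousLinearMap.le_of_opNorm_le _ hb' l
    · rintro _ ⟨_, ⟨f, hf, rfl⟩, rfl⟩
      obtain ⟨g, hg, hfg⟩ := hS f hf
      refine ⟨_, ⟨_, hg, rfl⟩,
        NormedSpace.inclusionInDoubleDualWeak ℝ E (toWeakSpace ℝ E (f - g)), ?_, ?_⟩
      · exact (mem_closedBall_zero_iff (E := StrongDual ℝ (StrongDual ℝ E))).2 ((NormedSpace.double_dual_bound ℝ E (f - g)).trans hfg)
      · simp only
        rw [← map_add, ← map_add, add_sub_cancel]
  obtain ⟨x, hx⟩ := mem_range_of_forall_exists_norm_sub_le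
    (NormedSpace.inclusionInDoubleDualLi (E := E) ℝ) (y := WeakDual.toStrongDual ξ) (by
      intro ε hε
      obtain ⟨x, hx⟩ := key ε hε
      exact ⟨x, ContinuousLinearMap.opNorm_le_bound _ hε.le hx⟩)
  refine ⟨toWeakSpace ℝ E x, ?_⟩
  apply WeakDual.toStrongDual.injective
  rw [← hx]
  rfl

/-- Closed balls of a real Hilbert space are weakly relatively compact. -/
theorem isCompact_closure_toWeakSpace_of_isBounded {H : Type*} [NormedAddCommGroup H]
    [InnerProductSpace ℝ H] [CompleteSpace H] {S : Set H} (hS : Bornology.IsBounded S) :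
    IsCompact (closure (toWeakSpace ℝ H '' S)) := by
  apply NormedSpace.isCompact_closure_of_isBounded ℝ H
  · rwa [Set.preimage_image_eq _ (toWeakSpace ℝ H).injective]
  · intro ξ _
    let ξ' : StrongDual ℝ (StrongDual ℝ H) := WeakDual.toStrongDual ξ
    let T : H →L[ℝ] StrongDual ℝ H := innerSL ℝ
    -- Riesz representation, applied twice, turns an arbitrary element of the bidual into a vector
    -- of H, so reflexivity removes the condition on the closure.
    obtain ⟨v, hv⟩ := (InnerProductSpace.toDual ℝ H).surjective (ξ'.comp T)
    refine ⟨toWeakSpace ℝ H v, ?_⟩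
    apply DFunLike.ext
    intro l
    obtain ⟨u, rfl⟩ := (InnerProductSpace.toDual ℝ H).surjective l
    have := congrArg (fun φ => φ u) hv
    simp only [InnerProductSpace.toDual_apply_apply] at this
    change (InnerProductSpace.toDual ℝ H u) v = ξ' (T u)
    rw [InnerProductSpace.toDual_apply_apply, real_inner_comm, this]
    rfl

/-- Weakly bounded sets are bounded. -/
theorem exists_norm_le_of_isCompact_toWeakSpace {K : Set (WeakSpace ℝ E)} (hK : IsCompact K) :
    ∃ M : ℝ, 0 < M ∧ ∀ x : E, toWeakSpace ℝ E x ∈ K → ‖x‖ ≤ M := by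
  -- The points of K are viewed as functionals on the dual; each l is bounded on K because its image
  -- there is compact.
  obtain ⟨C, hC⟩ := banach_steinhaus
    (g := fun x : {x : E // toWeakSpace ℝ E x ∈ K} =>
      NormedSpace.inclusionInDoubleDual ℝ E x.1) (by
    intro l
    have hc : Continuous fun x : WeakSpace ℝ E => l ((toWeakSpace ℝ E).symm x) :=
      WeakBilin.eval_continuous (topDualPairing ℝ E).flip l
    obtain ⟨C, hC⟩ := (hK.image hc).isBounded.exists_norm_le
    exact ⟨C, fun x => hC _ ⟨_, x.2, by simp⟩⟩)
  refine ⟨max C 1, by positivity, fun x hx => ?_⟩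
  have := hC ⟨x, hx⟩
  have h2 : ‖NormedSpace.inclusionInDoubleDual ℝ E x‖ = ‖x‖ :=
    (NormedSpace.inclusionInDoubleDualLi (E := E) ℝ).norm_map x
  simp only [h2] at this
  exact this.trans (le_max_left _ _)

/-- In a separable normed space, every sequence in a weakly compact set has a weakly convergent
subsequence. -/
theorem exists_subseq_tendsto_of_isCompact_toWeakSpace [SeparableSpace E]
    {K : Set (WeakSpace ℝ E)} (hK : IsCompact K) (f : ℕ → E)
    (hf : ∀ n, toWeakSpace ℝ E (f n) ∈ K) :
    ∃ g : E, ∃ φ : ℕ → ℕ, StrictMono φ ∧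
      ∀ l : StrongDual ℝ E, Tendsto (fun n => l (f (φ n))) atTop (𝓝 (l g)) := by
  have hcomp : CompactSpace K := isCompact_iff_compactSpace.mp hK
  -- Norming functionals of a dense sequence form a countable separating family, so the compact set
  -- is metrizable and hence sequentially compact.
  choose L hL1 hL2 using fun n => exists_dual_vector'' ℝ (denseSeq E n)
  have hc (l : StrongDual ℝ E) : Continuous fun x : WeakSpace ℝ E => l ((toWeakSpace ℝ E).symm x) :=
      WeakBilin.eval_continuous (topDualPairing ℝ E).flip l
  have hmet : MetrizableSpace K := by
    refine Metric.PiNatEmbed.TopologicalSpace.MetrizableSpace.of_countable_separating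
      (fun n k ↦ L n ((toWeakSpace ℝ E).symm k)) (fun n ↦ (hc _).comp continuous_subtype_val) ?_
    intro x y hxy
    by_contra! hcon
    apply hxy
    apply Subtype.ext
    apply (toWeakSpace ℝ E).symm.injective
    rw [← sub_eq_zero, ← norm_le_zero_iff]
    set z := (toWeakSpace ℝ E).symm x.1 - (toWeakSpace ℝ E).symm y.1 with hz
    have hLz (n : ℕ) : L n z = 0 := by rw [hz, map_sub, hcon n, sub_self]
    refine le_of_forall_pos_le_add fun ε hε => ?_
    obtain ⟨n, hn⟩ := (denseRange_denseSeq E).exists_dist_lt z (half_pos hε)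
    rw [dist_eq_norm] at hn
    -- Since `L n` kills z and norms the n-th dense vector, that vector is no longer than its
    -- distance to z; hence the norm of z is at most twice this distance.
    have h1 : ‖denseSeq E n‖ ≤ ‖z - denseSeq E n‖ := by
      have e : (L n) (denseSeq E n - z) = ‖denseSeq E n‖ := by
        rw [map_sub, hLz, sub_zero, hL2]; simp
      have h3 := (L n).le_of_opNorm_le (hL1 n) (denseSeq E n - z)
      rw [e, one_mul, norm_norm, norm_sub_rev] at h3
      exact h3
    have h2 := norm_add_le (z - denseSeq E n) (denseSeq E n)
    rw [sub_add_cancel] at h2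
    linarith
  have : FirstCountableTopology K := by
    let _ := metrizableSpaceMetric K
    infer_instance
  obtain ⟨g, φ, hφ, hlim⟩ := CompactSpace.tendsto_subseq fun n => (⟨_, hf n⟩ : K)
  refine ⟨(toWeakSpace ℝ E).symm g, φ, hφ, fun l => ?_⟩
  have := (((hc l).comp continuous_subtype_val).tendsto g).comp hlim
  simpa [Function.comp_def] using this

end WeakCompactness

/-! ### The Dunford–Pettis theorem over a finite measure -/

section DunfordPettis

variable {X : Type*} [MeasurableSpace X] {μ : Measure X}

/-- The inclusion of `L²` into `L¹` over a finite measure. -/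
noncomputable def lpTwoToLpOne (μ : Measure X) [IsFiniteMeasure μ] : Lp ℝ 2 μ →L[ℝ] Lp ℝ 1 μ :=
  LinearMap.mkContinuous
    { toFun := fun f => ((Lp.memLp f).mono_exponent one_le_two).toLp f
      map_add' := by
        intro f g
        rw [← MemLp.toLp_add]
        exact MemLp.toLp_congr _ _ (Lp.coeFn_add f g)
      map_smul' := by
        intro c f
        rw [RingHom.id_apply, ← MemLp.toLp_const_smul]
        exact MemLp.toLp_congr _ _ (Lp.coeFn_smul c f) }
    ((μ Set.univ ^ (1 / (1 : ENNReal).toReal - 1 / (2 : ENNReal).toReal)).toReal) (by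
      intro f
      have h := eLpNorm_le_eLpNorm_mul_rpow_measure_univ (μ := μ) (p := 1) (q := 2) one_le_two
        (Lp.aestronglyMeasurable f)
      change ‖((Lp.memLp f).mono_exponent one_le_two).toLp f‖ ≤ _
      rw [Lp.norm_toLp, Lp.norm_def, ← ENNReal.toReal_mul, mul_comm]
      refine ENNReal.toReal_mono ?_ h
      refine ENNReal.mul_ne_top (Lp.eLpNorm_ne_top f) ?_
      refine (ENNReal.rpow_lt_top_of_nonneg (by norm_num) (measure_ne_top _ _)).ne)

theorem coeFn_lpTwoToLpOne [IsFiniteMeasure μ] (f : Lp ℝ 2 μ) : lpTwoToLpOne μ f =ᵐ[μ] f :=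
  MemLp.coeFn_toLp ((Lp.memLp f).mono_exponent one_le_two)

theorem norm_eq_integral_abs (f : Lp ℝ 1 μ) : ‖f‖ = ∫ x, |f x| ∂μ :=
  L1.norm_eq_integral_norm f

/-- A bounded equi-integrable family in `L¹` over a finite measure is contained, up to small
errors, in weakly compact sets. -/
theorem exists_isCompact_approx_of_equiIntegrable [IsFiniteMeasure μ] {S : Set (Lp ℝ 1 μ)} {M : ℝ}
    (hM : 0 < M) (hb : ∀ f ∈ S, ‖f‖ ≤ M)
    (hS : ∀ ε > 0, ∃ δ > 0, ∀ f ∈ S, ∀ A, MeasurableSet A → μ A < ENNReal.ofReal δ →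
      ∫ x in A, |f x| ∂μ ≤ ε) :
    ∀ ε > 0, ∃ K : Set (WeakSpace ℝ (Lp ℝ 1 μ)), IsCompact K ∧
      ∀ f ∈ S, ∃ g : Lp ℝ 1 μ, toWeakSpace ℝ (Lp ℝ 1 μ) g ∈ K ∧ ‖f - g‖ ≤ ε := by
  intro ε hε
  obtain ⟨δ, hδ, hSδ⟩ := hS ε hε
  -- By Markov's inequality the set where |f| ≥ N has measure at most M / N = δ / 2, so
  -- equi-integrability applies to it.
  set N : ℝ := 2 * M / δ with hN
  have hN0 : 0 < N := by positivity
  -- The L² norm of any function bounded by N.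
  set R : ℝ := measureUnivNNReal μ ^ (2 : ENNReal).toReal⁻¹ * N with hR
  refine ⟨WeakSpace.map (lpTwoToLpOne μ) ''
    closure (toWeakSpace ℝ (Lp ℝ 2 μ) '' Metric.closedBall 0 R),
    (isCompact_closure_toWeakSpace_of_isBounded Metric.isBounded_closedBall).image
      (WeakSpace.map (lpTwoToLpOne μ)).continuous, ?_⟩
  intro f hf
  have hfm : Measurable f := (Lp.stronglyMeasurable f).measurable
  set A : Set X := {x | N ≤ |f x|} with hA
  have hAm : MeasurableSet A := measurableSet_le measurable_const hfm.abs
  have hfi := L1.integrable_coeFn f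
  have hAδ : μ A < ENNReal.ofReal δ := by
    have h1 := mul_meas_ge_le_integral_of_nonneg (μ := μ) (f := fun x => |f x|)
      (Eventually.of_forall fun x => abs_nonneg _) hfi.abs N
    rw [← norm_eq_integral_abs] at h1
    have h2 : N * μ.real A ≤ M := h1.trans (hb f hf)
    rw [ENNReal.lt_ofReal_iff_toReal_lt (measure_ne_top _ _)]
    change μ.real A < δ
    have h3 : 2 * M * μ.real A ≤ M * δ := by
      rw [hN, div_mul_eq_mul_div, div_le_iff₀ hδ] at h2
      exact h2
    nlinarith
  have hbd (x : X) : ‖Aᶜ.indicator f x‖ ≤ N := by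
    by_cases hx : x ∈ A
    · simp [hx, hN0.le]
    · rw [Set.indicator_of_mem (by exact hx), Real.norm_eq_abs]
      exact (not_le.1 hx).le
  have hmem : MemLp (Aᶜ.indicator f) 2 μ :=
    MemLp.of_bound (hfm.indicator hAm.compl).aestronglyMeasurable N (Eventually.of_forall hbd)
  refine ⟨lpTwoToLpOne μ (hmem.toLp _), ⟨toWeakSpace ℝ _ (hmem.toLp _), subset_closure ⟨_, ?_, rfl⟩,
    rfl⟩, ?_⟩
  · rw [mem_closedBall_zero_iff]
    refine Lp.norm_le_of_ae_bound hN0.le ?_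
    filter_upwards [hmem.coeFn_toLp] with x hx
    rw [hx]
    exact hbd x
  · rw [norm_eq_integral_abs]
    refine le_trans (le_of_eq ?_) (hSδ f hf A hAm hAδ)
    rw [← integral_indicator hAm]
    refine integral_congr_ae ?_
    filter_upwards [Lp.coeFn_sub f (lpTwoToLpOne μ (hmem.toLp _)), coeFn_lpTwoToLpOne (hmem.toLp _),
      hmem.coeFn_toLp] with x h1 h2 h3
    rw [h1, Pi.sub_apply, h2, h3]
    by_cases hx : x ∈ A
    · simp [hx]
    · simp [hx]

theorem exists_forall_setIntegral_abs_ge_le (f : Lp ℝ 1 μ) {ε : ℝ} (hε : 0 < ε) :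
    ∃ N : ℝ, 0 ≤ N ∧ ∫ x in {x | N ≤ |f x|}, |f x| ∂μ ≤ ε := by
  have hfm : Measurable f := (Lp.stronglyMeasurable f).measurable
  obtain ⟨N, hN0, hN⟩ := MemLp.integral_indicator_norm_ge_nonneg_le (Lp.memLp f) hε
  refine ⟨N, hN0, ?_⟩
  have hAm : MeasurableSet {x | N ≤ |f x|} := measurableSet_le measurable_const hfm.abs
  have e : ∫ x in {x | N ≤ |f x|}, |f x| ∂μ = ∫ x, ‖{x | N ≤ |f x|}.indicator f x‖ ∂μ := by
    rw [← integral_indicator hAm]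
    refine integral_congr_ae (Eventually.of_forall fun x => ?_)
    by_cases hx : N ≤ |f x| <;> simp [Set.indicator, hx]
  have hi := (L1.integrable_coeFn f).indicator hAm
  rw [e, ← ENNReal.ofReal_le_ofReal_iff hε.le, ofReal_integral_norm_eq_lintegral_enorm hi]
  exact hN

/-- Integrals of a single integrable function over small sets are small. -/
theorem exists_forall_setIntegral_abs_le (f : Lp ℝ 1 μ) {ε : ℝ} (hε : 0 < ε) :
    ∃ δ > 0, ∀ A, MeasurableSet A → μ A < ENNReal.ofReal δ → ∫ x in A, |f x| ∂μ ≤ ε := by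
  obtain ⟨δ, hδ, h⟩ := (Lp.memLp f).eLpNorm_indicator_le le_rfl (by simp) hε
  refine ⟨δ, hδ, fun A hA hAδ => ?_⟩
  have := h A hA hAδ.le
  have hi := (L1.integrable_coeFn f).indicator hA
  rw [eLpNorm_one_eq_lintegral_enorm, ← ofReal_integral_norm_eq_lintegral_enorm hi,
    ENNReal.ofReal_le_ofReal_iff hε.le] at this
  rw [← integral_indicator hA]
  refine le_trans (le_of_eq (integral_congr_ae (Eventually.of_forall fun x => ?_))) this
  by_cases hx : x ∈ A <;> simp [hx]

/-- Although g is only integrable, the pairing is continuous in the L¹ metric as long as h stays in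
the unit ball of L^∞: where |g| ≥ N the increment costs at most twice the small tail of g, elsewhere
at most N times the L¹ distance. This supplies the closed sets of the Baire argument below. -/
theorem continuousOn_integral_mul (g : Lp ℝ 1 μ) :
    ContinuousOn (fun h : Lp ℝ 1 μ => ∫ x, g x * h x ∂μ) {h | ∀ᵐ x ∂μ, |h x| ≤ 1} := by
  have hi (h : Lp ℝ 1 μ) (hh : ∀ᵐ x ∂μ, |h x| ≤ 1) : Integrable (fun x => g x * h x) μ :=
    (L1.integrable_coeFn g).mul_bdd (c := 1) (Lp.aestronglyMeasurable h) hh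
  have hgm : Measurable g := (Lp.stronglyMeasurable g).measurable
  rw [Metric.continuousOn_iff]
  intro h hh ε hε
  obtain ⟨N, hN0, hN⟩ := exists_forall_setIntegral_abs_ge_le g (show 0 < ε / 4 by positivity)
  refine ⟨ε / (2 * (N + 1)), by positivity, fun h' hh' hd => ?_⟩
  have hAm : MeasurableSet {x | N ≤ |g x|} := measurableSet_le measurable_const hgm.abs
  rw [dist_eq_norm, norm_eq_integral_abs] at hd
  rw [Real.dist_eq, ← integral_sub (hi h' hh') (hi h hh)]
  have hgi := ((L1.integrable_coeFn g).abs.indicator hAm).const_mul 2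
  have hdi := (L1.integrable_coeFn (h' - h)).abs.const_mul N
  have hle : |∫ x, (g x * h' x - g x * h x) ∂μ| ≤
      ∫ x, (2 * {x | N ≤ |g x|}.indicator (fun x => |g x|) x + N * |(h' - h) x|) ∂μ := by
    refine (abs_integral_le_integral_abs).trans ?_
    refine integral_mono_ae ((hi h' hh').sub (hi h hh)).abs (hgi.add hdi) ?_
    filter_upwards [hh, hh', Lp.coeFn_sub h' h] with x h1 h2 h3
    rw [h3, Pi.sub_apply, ← mul_sub, abs_mul]
    have h4 : |h' x - h x| ≤ 2 := (abs_sub _ _).trans (by linarith)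
    by_cases hx : N ≤ |g x|
    · rw [Set.indicator_of_mem (by exact hx)]
      have := mul_le_mul_of_nonneg_left h4 (abs_nonneg (g x))
      have := mul_nonneg hN0 (abs_nonneg (h' x - h x))
      linarith
    · rw [Set.indicator_of_notMem (by exact hx)]
      have := mul_le_mul_of_nonneg_right (not_le.1 hx).le (abs_nonneg (h' x - h x))
      linarith
  refine hle.trans_lt ?_
  rw [integral_add hgi hdi, integral_const_mul, integral_const_mul, integral_indicator hAm]
  have h5 : N * ∫ x, |(h' - h) x| ∂μ ≤ N * (ε / (2 * (N + 1))) :=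
    mul_le_mul_of_nonneg_left hd.le hN0
  have h6 : N * (ε / (2 * (N + 1))) < ε / 2 := by
    rw [← mul_div_assoc, div_lt_div_iff₀ (by positivity) (by norm_num)]
    nlinarith
  linarith

/-- Integration against a bounded function as a functional on `L¹`. -/
noncomputable def integralMulCLM (h : X → ℝ) (hm : AEStronglyMeasurable h μ) {C : ℝ}
    (hC : ∀ᵐ x ∂μ, |h x| ≤ C) : StrongDual ℝ (Lp ℝ 1 μ) :=
  LinearMap.mkContinuous
    { toFun := fun g => ∫ x, g x * h x ∂μ
      map_add' := by
        intro f g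
        rw [← integral_add ((L1.integrable_coeFn f).mul_bdd (c := C) hm hC)
          ((L1.integrable_coeFn g).mul_bdd (c := C) hm hC)]
        refine integral_congr_ae ?_
        filter_upwards [Lp.coeFn_add f g] with x hx
        rw [hx, Pi.add_apply, add_mul]
      map_smul' := by
        intro c f
        rw [RingHom.id_apply, smul_eq_mul, ← integral_const_mul]
        refine integral_congr_ae ?_
        filter_upwards [Lp.coeFn_smul c f] with x hx
        rw [hx, Pi.smul_apply, smul_eq_mul, mul_assoc] } C (by
      intro f
      change |∫ x, f x * h x ∂μ| ≤ _
      refine abs_integral_le_integral_abs.trans ?_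
      rw [norm_eq_integral_abs, ← integral_const_mul]
      refine integral_mono_ae ((L1.integrable_coeFn f).mul_bdd (c := C) hm hC).abs
        ((L1.integrable_coeFn f).abs.const_mul C) ?_
      filter_upwards [hC] with x hx
      rw [abs_mul, mul_comm]
      exact mul_le_mul_of_nonneg_right hx (abs_nonneg _))

theorem integralMulCLM_apply {h : X → ℝ} (hm : AEStronglyMeasurable h μ) {C : ℝ}
    (hC : ∀ᵐ x ∂μ, |h x| ≤ C) (g : Lp ℝ 1 μ) :
    integralMulCLM h hm hC g = ∫ x, g x * h x ∂μ := rfl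

/-- The set is the order interval between the constants -1 and 1. Closedness makes it a complete
metric space for the L¹ distance, to which Baire's theorem applies. -/
theorem isClosed_setOf_ae_abs_le_one [IsFiniteMeasure μ] :
    IsClosed {h : Lp ℝ 1 μ | ∀ᵐ x ∂μ, |h x| ≤ 1} := by
  have e : {h : Lp ℝ 1 μ | ∀ᵐ x ∂μ, |h x| ≤ 1} =
      Set.Icc (-(memLp_const (1 : ℝ)).toLp (fun _ : X => (1 : ℝ)))
        ((memLp_const (1 : ℝ)).toLp (fun _ : X => (1 : ℝ))) := by
    ext h
    rw [Set.mem_Icc, ← Lp.coeFn_le, ← Lp.coeFn_le, Filter.EventuallyLE, Filter.EventuallyLE,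
      ← Filter.eventually_and]
    have h1 := (memLp_const (μ := μ) (p := 1) (1 : ℝ)).coeFn_toLp
    have h2 := Lp.coeFn_neg ((memLp_const (μ := μ) (p := 1) (1 : ℝ)).toLp (fun _ : X => (1 : ℝ)))
    change (∀ᵐ x ∂μ, |h x| ≤ 1) ↔ _
    refine Filter.eventually_congr ?_
    filter_upwards [h1, h2] with x hx1 hx2
    rw [hx2, Pi.neg_apply, hx1, abs_le]
  rw [e]
  exact isClosed_Icc

/-- Vitali-Hahn-Saks: a weakly null sequence in `L¹` is eventually uniformly integrable. -/
theorem exists_forall_ge_setIntegral_abs_le [IsFiniteMeasure μ] {g : ℕ → Lp ℝ 1 μ}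
    (hg : ∀ l : StrongDual ℝ (Lp ℝ 1 μ), Tendsto (fun n => l (g n)) atTop (𝓝 0))
    {ε : ℝ} (hε : 0 < ε) :
    ∃ δ > 0, ∃ m, ∀ n ≥ m, ∀ A, MeasurableSet A → μ A < ENNReal.ofReal δ →
      ∫ x in A, |g n x| ∂μ ≤ ε := by
  set B : Set (Lp ℝ 1 μ) := {h | ∀ᵐ x ∂μ, |h x| ≤ 1} with hB
  have : CompleteSpace B := (isClosed_setOf_ae_abs_le_one (μ := μ)).completeSpace_coe
  have : Nonempty B := ⟨⟨0, by
    filter_upwards [Lp.coeFn_zero ℝ 1 μ] with x hx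
    rw [hx]
    simp⟩⟩
  -- Weak nullness, tested against each h in B, says that these closed sets cover B; by Baire one of
  -- them contains a ball about some `h0`.
  obtain ⟨m, ⟨h0, hh0⟩, hint⟩ := nonempty_interior_of_iUnion_of_closed
    (f := fun m => {h : B | ∀ n ≥ m, |∫ x, g n x * h.1 x ∂μ| ≤ ε}) (by
      intro m
      simp only [Set.ofPred_forall]
      refine isClosed_iInter fun n => isClosed_iInter fun _ => ?_
      exact isClosed_le (continuousOn_iff_continuous_domRestrict.1
        (continuousOn_integral_mul (g n))).abs continuous_const) (by
      refine Set.eq_univ_of_forall fun h => ?_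
      have := hg (integralMulCLM h.1 (Lp.aestronglyMeasurable _) h.2)
      obtain ⟨m, hm⟩ := Metric.tendsto_atTop.1 this ε hε
      refine Set.mem_iUnion.2 ⟨m, fun n hn => ?_⟩
      have := hm n hn
      rw [Real.dist_eq, sub_zero, integralMulCLM_apply] at this
      exact this.le)
  rw [mem_interior_iff_mem_nhds, Metric.mem_nhds_iff] at hint
  obtain ⟨r, hr, hball⟩ := hint
  -- Changing `h0` on A within the values [-1, 1] moves it by at most 2 μ(A) < r in L¹, so the
  -- modified function is still in the ball.
  refine ⟨r / 2, by positivity, m, fun n hn A hA hAδ => ?_⟩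
  have hAr : μ.real A < r / 2 := by
    rwa [ENNReal.lt_ofReal_iff_toReal_lt (measure_ne_top _ _)] at hAδ
  have hgm : Measurable (g n) := (Lp.stronglyMeasurable _).measurable
  have hs : Measurable fun x => if 0 ≤ g n x then (1 : ℝ) else -1 :=
    Measurable.ite (measurableSet_le measurable_const hgm) measurable_const measurable_const
  classical
  have key : ∀ c : ℝ, |c| = 1 → |∫ x, g n x *
      A.piecewise (fun x => c * if 0 ≤ g n x then (1 : ℝ) else -1) h0 x ∂μ| ≤ ε := by
    intro c hc
    set k : X → ℝ := A.piecewise (fun x => c * if 0 ≤ g n x then (1 : ℝ) else -1) h0 with hk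
    have hkm : Measurable k :=
      Measurable.piecewise hA (hs.const_mul c) (Lp.stronglyMeasurable h0).measurable
    have hkb : ∀ᵐ x ∂μ, |k x| ≤ 1 := by
      filter_upwards [hh0] with x hx
      by_cases hxA : x ∈ A
      · rw [hk, Set.piecewise_eq_of_mem _ _ _ hxA, abs_mul, hc, one_mul]
        split_ifs <;> simp
      · rwa [hk, Set.piecewise_eq_of_notMem _ _ _ hxA]
    have hkL : MemLp k 1 μ := MemLp.of_bound hkm.aestronglyMeasurable 1 hkb
    have hkB : hkL.toLp k ∈ B := by
      filter_upwards [hkb, hkL.coeFn_toLp] with x h1 h2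
      rwa [h2]
    have hdist : dist (⟨hkL.toLp k, hkB⟩ : B) ⟨h0, hh0⟩ < r := by
      rw [Subtype.dist_eq, dist_eq_norm, norm_eq_integral_abs]
      have hle : ∫ x, |(hkL.toLp k - h0) x| ∂μ ≤ ∫ x, A.indicator (fun _ => (2 : ℝ)) x ∂μ := by
        refine integral_mono_ae (L1.integrable_coeFn _).abs
          ((integrable_const (2 : ℝ)).indicator hA) ?_
        filter_upwards [hkb, hkL.coeFn_toLp, Lp.coeFn_sub (hkL.toLp k) h0, hh0] with x h1 h2 h3 h4
        rw [h3, Pi.sub_apply, h2]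
        by_cases hxA : x ∈ A
        · rw [Set.indicator_of_mem hxA]
          exact (abs_sub _ _).trans (by linarith)
        · rw [Set.indicator_of_notMem hxA, hk, Set.piecewise_eq_of_notMem _ _ _ hxA]
          simp
      refine hle.trans_lt ?_
      rw [integral_indicator hA, setIntegral_const, smul_eq_mul]
      linarith
    have := hball (Metric.mem_ball.2 hdist) n hn
    refine le_trans (le_of_eq ?_) this
    congr 1
    refine integral_congr_ae ?_
    filter_upwards [hkL.coeFn_toLp] with x hx
    rw [hx]
  have hi : ∀ c : ℝ, |c| = 1 → Integrable (fun x => g n x *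
      A.piecewise (fun x => c * if 0 ≤ g n x then (1 : ℝ) else -1) h0 x) μ := by
    intro c hc
    refine (L1.integrable_coeFn (g n)).mul_bdd (c := 1) (Measurable.piecewise hA (hs.const_mul c)
      (Lp.stronglyMeasurable h0).measurable).aestronglyMeasurable ?_
    filter_upwards [hh0] with x hx
    by_cases hxA : x ∈ A
    · rw [Set.piecewise_eq_of_mem _ _ _ hxA, norm_mul, Real.norm_eq_abs, hc, one_mul]
      split_ifs <;> simp
    · rwa [Set.piecewise_eq_of_notMem _ _ _ hxA]
  have k1 := key 1 (by simp)
  have k2 := key (-1) (by simp)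
  -- The two competitors carry sign(g) and -sign(g) on A and agree with `h0` elsewhere. Their
  -- difference cancels the unknown contribution off A.
  have e : 2 * ∫ x in A, |g n x| ∂μ =
      (∫ x, g n x * A.piecewise (fun x => 1 * if 0 ≤ g n x then (1 : ℝ) else -1) h0 x ∂μ) -
      ∫ x, g n x * A.piecewise (fun x => (-1) * if 0 ≤ g n x then (1 : ℝ) else -1) h0 x ∂μ := by
    rw [← integral_sub (hi 1 (by simp)) (hi (-1) (by simp)), ← integral_indicator hA,
      ← integral_const_mul]
    congr 1
    ext x
    by_cases hxA : x ∈ A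
    · rw [Set.indicator_of_mem hxA, Set.piecewise_eq_of_mem _ _ _ hxA,
        Set.piecewise_eq_of_mem _ _ _ hxA]
      split_ifs with h
      · rw [abs_of_nonneg h]; ring
      · rw [abs_of_neg (not_le.1 h)]; ring
    · rw [Set.indicator_of_notMem hxA, Set.piecewise_eq_of_notMem _ _ _ hxA,
        Set.piecewise_eq_of_notMem _ _ _ hxA]
      ring
  have := abs_le.1 k1
  have := abs_le.1 k2
  linarith

/-- Weakly compact sets in `L¹` are equi-integrable. -/
theorem equiIntegrable_of_isCompact_toWeakSpace [IsFiniteMeasure μ] [SeparableSpace (Lp ℝ 1 μ)]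
    {K : Set (WeakSpace ℝ (Lp ℝ 1 μ))} (hK : IsCompact K) {ε : ℝ} (hε : 0 < ε) :
    ∃ δ > 0, ∀ f : Lp ℝ 1 μ, toWeakSpace ℝ (Lp ℝ 1 μ) f ∈ K → ∀ A, MeasurableSet A →
      μ A < ENNReal.ofReal δ → ∫ x in A, |f x| ∂μ ≤ ε := by
  by_contra! hcon
  choose f hfK A hA hAδ hfA using fun n : ℕ => hcon (1 / ((n : ℝ) + 1)) (by positivity)
  obtain ⟨g, φ, hφ, hlim⟩ := exists_subseq_tendsto_of_isCompact_toWeakSpace hK f hfK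
  -- The limit g is subtracted to get a weakly null sequence; g itself is handled by absolute
  -- continuity of its integral.
  obtain ⟨δ₁, hδ₁, m, hm⟩ := exists_forall_ge_setIntegral_abs_le
    (g := fun n => f (φ n) - g) (fun l => by
      simpa using (hlim l).sub_const (l g)) (half_pos hε)
  obtain ⟨δ₂, hδ₂, hg⟩ := exists_forall_setIntegral_abs_le g (half_pos hε)
  obtain ⟨N, hN⟩ := exists_nat_one_div_lt (lt_min hδ₁ hδ₂)
  set n := max m N
  have hn : μ (A (φ n)) < ENNReal.ofReal (min δ₁ δ₂) := by
    refine (hAδ (φ n)).trans_le (ENNReal.ofReal_le_ofReal (le_trans ?_ hN.le))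
    have : (N : ℝ) ≤ φ n := by exact_mod_cast (le_max_right m N).trans (hφ.id_le n)
    gcongr
  have h1 := hm n (le_max_left _ _) (A (φ n)) (hA _)
    (hn.trans_le (ENNReal.ofReal_le_ofReal (min_le_left _ _)))
  have h2 := hg (A (φ n)) (hA _) (hn.trans_le (ENNReal.ofReal_le_ofReal (min_le_right _ _)))
  have h3 : ∫ x in A (φ n), |f (φ n) x| ∂μ ≤
      ∫ x in A (φ n), (|(f (φ n) - g) x| + |g x|) ∂μ := by
    refine integral_mono_ae (L1.integrable_coeFn _).abs.integrableOn
      ((L1.integrable_coeFn _).abs.add (L1.integrable_coeFn _).abs).integrableOn ?_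
    refine ae_restrict_of_ae ?_
    filter_upwards [Lp.coeFn_sub (f (φ n)) g] with x hx
    rw [hx, Pi.sub_apply]
    have := abs_add_le (f (φ n) x - g x) (g x)
    rwa [sub_add_cancel] at this
  rw [integral_add (L1.integrable_coeFn _).abs.integrableOn
    (L1.integrable_coeFn _).abs.integrableOn] at h3
  linarith [hfA (φ n)]

end DunfordPettis

namespace Sobolev

/-! ### Iterated partial derivatives and weak derivatives of weak derivatives -/

section Calculus

variable {d : ℕ}

theorem contDiff_pderiv (i : Fin d) {φ : EuclideanSpace ℝ (Fin d) → ℝ} (h : ContDiff ℝ ∞ φ) :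
    ContDiff ℝ ∞ (pderiv i φ) :=
  (h.fderiv_right (m := ∞) (by simp)).clm_apply contDiff_const

theorem pderiv_comm (i j : Fin d) {φ : EuclideanSpace ℝ (Fin d) → ℝ} (h : ContDiff ℝ ∞ φ) :
    pderiv i (pderiv j φ) = pderiv j (pderiv i φ) := by
  have hd : Differentiable ℝ (fderiv ℝ φ) :=
    (h.fderiv_right (m := ∞) (by simp)).differentiable (by simp)
  have e (i j : Fin d) (x : EuclideanSpace ℝ (Fin d)) : pderiv i (pderiv j φ) x =
      fderiv ℝ (fderiv ℝ φ) x (EuclideanSpace.single i 1) (EuclideanSpace.single j 1) := by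
    unfold pderiv
    rw [fderiv_clm_apply (hd x) (differentiableAt_const _)]
    simp
  ext x
  rw [e, e]
  exact (h.contDiffAt.isSymmSndFDerivAt (by
    rw [minSmoothness_of_isRCLikeNormedField]; exact WithTop.coe_le_coe.2 le_top)) _ _

theorem contDiff_iterate_pderiv (i : Fin d) (n : ℕ) {φ : EuclideanSpace ℝ (Fin d) → ℝ}
    (h : ContDiff ℝ ∞ φ) : ContDiff ℝ ∞ ((pderiv i)^[n] φ) := by
  induction n with
  | zero => exact h
  | succ n ih =>
    rw [Function.iterate_succ_apply']
    exact contDiff_pderiv i ih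

theorem iterate_pderiv_comm (i j : Fin d) (n : ℕ) {φ : EuclideanSpace ℝ (Fin d) → ℝ}
    (h : ContDiff ℝ ∞ φ) : (pderiv i)^[n] (pderiv j φ) = pderiv j ((pderiv i)^[n] φ) := by
  induction n with
  | zero => rfl
  | succ n ih =>
    rw [Function.iterate_succ_apply', Function.iterate_succ_apply', ih,
      pderiv_comm i j (contDiff_iterate_pderiv i n h)]

theorem mderiv_eq_foldr (α : Fin d → ℕ) (φ : EuclideanSpace ℝ (Fin d) → ℝ) :
    mderiv α φ = (List.finRange d).foldr (fun i ψ => (pderiv i)^[α i] ψ) φ := by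
  rw [mderiv, List.ofFn_eq_map, List.foldr_map]

theorem foldr_pderiv_comm (l : List (Fin d)) (α : Fin d → ℕ) (i : Fin d)
    {φ : EuclideanSpace ℝ (Fin d) → ℝ} (h : ContDiff ℝ ∞ φ) :
    ContDiff ℝ ∞ (l.foldr (fun i ψ => (pderiv i)^[α i] ψ) φ) ∧
    l.foldr (fun i ψ => (pderiv i)^[α i] ψ) (pderiv i φ) =
      pderiv i (l.foldr (fun i ψ => (pderiv i)^[α i] ψ) φ) := by
  induction l with
  | nil => exact ⟨h, rfl⟩
  | cons j l ih =>
    simp only [List.foldr_cons]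
    exact ⟨contDiff_iterate_pderiv _ _ ih.1, by rw [ih.2, iterate_pderiv_comm _ _ _ ih.1]⟩

/-- The extra derivative sits in the i-th block and has to commute past the blocks to its right.
Absence of duplicates ensures that it is counted exactly once. -/
theorem foldr_pderiv_add_single (l : List (Fin d)) (hl : l.Nodup) (α : Fin d → ℕ) (i : Fin d)
    {φ : EuclideanSpace ℝ (Fin d) → ℝ} (h : ContDiff ℝ ∞ φ) :
    (i ∉ l → l.foldr (fun j ψ => (pderiv j)^[(α + Pi.single i 1 : Fin d → ℕ) j] ψ) φ =
      l.foldr (fun j ψ => (pderiv j)^[α j] ψ) φ) ∧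
    (i ∈ l → l.foldr (fun j ψ => (pderiv j)^[(α + Pi.single i 1 : Fin d → ℕ) j] ψ) φ =
      l.foldr (fun j ψ => (pderiv j)^[α j] ψ) (pderiv i φ)) := by
  induction l with
  | nil => simp
  | cons j l ih =>
    obtain ⟨hj, hl⟩ := List.nodup_cons.1 hl
    obtain ⟨ih1, ih2⟩ := ih hl
    simp only [List.foldr_cons, List.mem_cons, not_or]
    constructor
    · rintro ⟨hij, hi⟩
      rw [ih1 hi, Pi.add_apply, Pi.single_eq_of_ne (Ne.symm hij), add_zero]
    · intro hi
      by_cases hij : i = j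
      · subst hij
        rw [ih1 hj, (foldr_pderiv_comm l α i h).2, Pi.add_apply, Pi.single_eq_same,
          Function.iterate_succ_apply]
      · rw [ih2 (hi.resolve_left hij), Pi.add_apply, Pi.single_eq_of_ne (Ne.symm hij), add_zero]

theorem mderiv_pderiv (α : Fin d → ℕ) (i : Fin d) {φ : EuclideanSpace ℝ (Fin d) → ℝ}
    (h : ContDiff ℝ ∞ φ) : mderiv α (pderiv i φ) = mderiv (α + Pi.single i 1) φ := by
  rw [mderiv_eq_foldr, mderiv_eq_foldr]
  exact ((foldr_pderiv_add_single _ (List.nodup_finRange d) α i h).2 (List.mem_finRange i)).symm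

theorem sum_add_single (α : Fin d → ℕ) (i : Fin d) :
    ∑ j, (α + Pi.single i 1 : Fin d → ℕ) j = ∑ j, α j + 1 := by
  simp [Finset.sum_add_distrib]

variable {Ω : Opens (EuclideanSpace ℝ (Fin d))} {k : ℕ}

/-- Testing the definition of D^α f with ∂_i φ produces D^{α+e_i} on the test function; the signs
differ by one factor -1. So each derivative of order below k has a weak gradient of its own. -/
theorem integral_D_mul_pderiv (f : SobolevSpace Ω k) {α : Fin d → ℕ} (hα : ∑ j, α j + 1 ≤ k)
    (i : Fin d) {φ : EuclideanSpace ℝ (Fin d) → ℝ} (h1 : ContDiff ℝ ∞ φ)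
    (h2 : HasCompactSupport φ) (h3 : tsupport φ ⊆ Ω) :
    ∫ x in (Ω : Set (EuclideanSpace ℝ (Fin d))), f.D α x * pderiv i φ x =
      -∫ x in (Ω : Set (EuclideanSpace ℝ (Fin d))), f.D (α + Pi.single i 1) x * φ x := by
  have hs := pderiv_smooth i ⟨h1, h2⟩
  have e1 := SobolevSpace.isWeakDeriv_D (α := α) (by omega) f (pderiv i φ) hs.1 hs.2
    ((tsupport_fderiv_apply_subset ℝ _).trans h3)
  have e2 := SobolevSpace.isWeakDeriv_D (α := α + Pi.single i 1) (by rw [sum_add_single]; exact hα)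
    f φ h1 h2 h3
  rw [mderiv_pderiv α i h1, e2, sum_add_single, pow_succ, mul_assoc] at e1
  have := mul_left_cancel₀ (pow_ne_zero _ (by norm_num)) e1
  linarith

end Calculus

/-! ### Weak derivatives along segments -/

section Translation

/-- `g` is the weak derivative of `u` on `Ω` in the direction `z`. -/
def HasWeakDirDeriv {E : Type*} [NormedAddCommGroup E] [NormedSpace ℝ E] [MeasurableSpace E]
    (μ : Measure E) (Ω : Set E) (z : E) (u g : E → ℝ) : Prop :=
  ∀ φ : E → ℝ, ContDiff ℝ ∞ φ → HasCompactSupport φ → tsupport φ ⊆ Ω →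
    ∫ x, u x * fderiv ℝ φ x z ∂μ = -∫ x, g x * φ x ∂μ

theorem HasWeakDirDeriv.smul {E : Type*} [NormedAddCommGroup E] [NormedSpace ℝ E]
    [MeasurableSpace E] {μ : Measure E} {Ω : Set E} {z : E} {u g : E → ℝ}
    (h : HasWeakDirDeriv μ Ω z u g) (t : ℝ) :
    HasWeakDirDeriv μ Ω (t • z) u (fun x => t * g x) := by
  intro φ h1 h2 h3
  have e1 : ∀ x, u x * fderiv ℝ φ x (t • z) = t * (u x * fderiv ℝ φ x z) := by
    intro x; rw [map_smul, smul_eq_mul]; ring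
  simp_rw [e1, mul_assoc, integral_const_mul]
  rw [h φ h1 h2 h3, mul_neg]

/-- The points whose translates by `K` remain in `Ω`. -/
def core {E : Type*} [Add E] (Ω K : Set E) : Set E := {x | ∀ y ∈ K, x + y ∈ Ω}

theorem core_anti {E : Type*} [Add E] {Ω K L : Set E} (h : K ⊆ L) : core Ω L ⊆ core Ω K :=
  fun _ hx y hy => hx y (h hy)

/-- The complement is the difference of a closed set and a compact set, hence closed. -/
theorem isOpen_core {E : Type*} [NormedAddCommGroup E] {Ω K : Set E} (hΩ : IsOpen Ω)
    (hK : IsCompact K) : IsOpen (core Ω K) := by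
  have e : core Ω K = (Ωᶜ - K)ᶜ := by
    ext x
    simp only [core, Set.mem_ofPred_eq, Set.mem_compl_iff, Set.mem_sub, not_exists, not_and]
    constructor
    · intro h a ha y hy hxy
      refine ha ?_
      have := h y hy
      rwa [← hxy, sub_add_cancel] at this
    · intro h y hy
      by_contra hcon
      exact h (x + y) hcon y hy (by simp)
  rw [e, isOpen_compl_iff, sub_eq_add_neg]
  exact hΩ.isClosed_compl.add_right_of_isCompact hK.neg

variable {E : Type*} [NormedAddCommGroup E] [NormedSpace ℝ E]

theorem isCompact_segment_zero (z : E) : IsCompact (segment ℝ 0 z) := by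
  rw [segment_eq_image]
  exact isCompact_Icc.image (by fun_prop)

theorem smul_mem_segment_zero (z : E) {t : ℝ} (ht : t ∈ Set.Icc (0 : ℝ) 1) :
    t • z ∈ segment ℝ 0 z := by
  rw [segment_eq_image]
  exact ⟨t, ht, by simp⟩

variable [MeasurableSpace E] [BorelSpace E] [FiniteDimensional ℝ E] {μ : Measure E}
  [μ.IsAddHaarMeasure]

theorem integrable_prod_translate {g : E → ℝ} (hgm : Measurable g) (hg : Integrable g μ) (z : E) :
    Integrable (fun p : E × ℝ => g (p.1 + p.2 • z))
      (μ.prod (volume.restrict (Set.Ioc (0 : ℝ) 1))) := by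
  rw [integrable_prod_iff']
  · refine ⟨Eventually.of_forall fun t => hg.comp_add_right (t • z), ?_⟩
    have : ∀ t : ℝ, ∫ x, ‖g (x + t • z)‖ ∂μ = ∫ x, ‖g x‖ ∂μ := fun t =>
      integral_add_right_eq_self (fun x => ‖g x‖) _
    simp_rw [this]
    exact integrable_const _
  · have : Measurable fun p : E × ℝ => p.1 + p.2 • z :=
      (by fun_prop : Continuous fun p : E × ℝ => p.1 + p.2 • z).measurable
    exact (hgm.comp this).aestronglyMeasurable

/-- The translation is moved onto φ, where the classical fundamental theorem applies. After Fubini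
the weak derivative is tested with φ(· - t z), which is supported in Ω exactly because φ is
supported in the core of the segment. -/
theorem integral_mul_translate_sub {Ω : Set E} {z : E} {u g : E → ℝ}
    (hu : Integrable u μ) (hgm : Measurable g) (hg : Integrable g μ)
    (h : HasWeakDirDeriv μ Ω z u g) {φ : E → ℝ} (h1 : ContDiff ℝ ∞ φ) (h2 : HasCompactSupport φ)
    (h3 : tsupport φ ⊆ core Ω (segment ℝ 0 z)) :
    ∫ x, (u (x + z) - u x) * φ x ∂μ =
      ∫ x, (∫ t in Set.Ioc (0 : ℝ) 1, g (x + t • z)) * φ x ∂μ := by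
  obtain ⟨C, hC⟩ := h1.continuous.bounded_above_of_compact_support h2
  have hφ' : Continuous fun x => fderiv ℝ φ x z :=
    (h1.continuous_fderiv (by simp)).clm_apply continuous_const
  obtain ⟨C', hC'⟩ := hφ'.bounded_above_of_compact_support (h2.fderiv_apply (𝕜 := ℝ) z)
  have hb {v : E → ℝ} (hv : Integrable v μ) : Integrable (fun x => v x * φ x) μ :=
    hv.mul_bdd (c := C) h1.continuous.aestronglyMeasurable (Eventually.of_forall hC)
  have htr : ∫ x, u (x + z) * φ x ∂μ = ∫ x, u x * φ (x - z) ∂μ := by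
    rw [← integral_add_right_eq_self (fun x => u x * φ (x - z)) z]
    simp
  have hb' : Integrable (fun x => u x * φ (x - z)) μ :=
    hu.mul_bdd (c := C) (by fun_prop) (Eventually.of_forall fun x => hC _)
  have hft (x : E) : φ (x - z) - φ x = -∫ t in Set.Ioc (0 : ℝ) 1, fderiv ℝ φ (x - t • z) z := by
    rw [← intervalIntegral.integral_of_le zero_le_one]
    have := intervalIntegral.integral_eq_sub_of_hasDerivAt (a := 0) (b := 1)
      (f := fun t : ℝ => φ (x - t • z)) (f' := fun t => -fderiv ℝ φ (x - t • z) z) (by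
        intro t _
        have hd : HasDerivAt (fun t : ℝ => x - t • z) (-z) t := by
          simpa using ((hasDerivAt_id t).smul_const z).const_sub x
        have := ((h1.differentiable (by simp)) (x - t • z)).hasFDerivAt.comp_hasDerivAt t hd
        simpa [Function.comp_def] using this)
      ((by fun_prop : Continuous fun t : ℝ => -fderiv ℝ φ (x - t • z) z).intervalIntegrable _ _)
    rw [intervalIntegral.integral_neg] at this
    simpa using this.symm
  have hF1 : Integrable (fun p : E × ℝ => u p.1 * fderiv ℝ φ (p.1 - p.2 • z) z)
      (μ.prod (volume.restrict (Set.Ioc (0 : ℝ) 1))) :=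
    (hu.comp_fst _).mul_bdd (c := C') (by fun_prop) (Eventually.of_forall fun p => hC' _)
  have hF2 : Integrable (fun p : E × ℝ => g (p.1 + p.2 • z) * φ p.1)
      (μ.prod (volume.restrict (Set.Ioc (0 : ℝ) 1))) :=
    (integrable_prod_translate hgm hg z).mul_bdd (c := C) (by fun_prop)
      (Eventually.of_forall fun p => hC _)
  have hshift (t : ℝ) (ht : t ∈ Set.Ioc (0 : ℝ) 1) :
      ∫ x, u x * fderiv ℝ φ (x - t • z) z ∂μ = -∫ x, g (x + t • z) * φ x ∂μ := by
    have hh := h (fun x => φ (x - t • z)) (by fun_prop)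
      (h2.comp_homeomorph (Homeomorph.subRight (t • z))) (by
        intro x hx
        have hx' : x - t • z ∈ tsupport φ := by
          have := tsupport_comp_eq_preimage φ (Homeomorph.subRight (t • z))
          exact this.subset hx
        have := h3 hx' (t • z) (smul_mem_segment_zero z ⟨ht.1.le, ht.2⟩)
        simpa using this)
    simp_rw [fderiv_comp_sub] at hh
    rw [hh, ← integral_add_right_eq_self (fun x => g x * φ (x - t • z)) (t • z)]
    simp
  calc ∫ x, (u (x + z) - u x) * φ x ∂μ
      = ∫ x, u x * (φ (x - z) - φ x) ∂μ := by
        simp_rw [sub_mul, mul_sub]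
        rw [integral_sub (hb (hu.comp_add_right z)) (hb hu), htr, integral_sub hb' (hb hu)]
    _ = -∫ x, (∫ t in Set.Ioc (0 : ℝ) 1, u x * fderiv ℝ φ (x - t • z) z) ∂μ := by
        simp_rw [hft, integral_const_mul, mul_neg, integral_neg]
    _ = -∫ t in Set.Ioc (0 : ℝ) 1, ∫ x, u x * fderiv ℝ φ (x - t • z) z ∂μ := by
        rw [integral_integral_swap hF1]
    _ = ∫ t in Set.Ioc (0 : ℝ) 1, ∫ x, g (x + t • z) * φ x ∂μ := by
        rw [← integral_neg]
        refine setIntegral_congr_fun measurableSet_Ioc fun t ht => ?_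
        simp only [hshift t ht, neg_neg]
    _ = ∫ x, (∫ t in Set.Ioc (0 : ℝ) 1, g (x + t • z) * φ x) ∂μ := by
        exact (integral_integral_swap (f := fun x (t : ℝ) => g (x + t • z) * φ x) hF2).symm
    _ = _ := by simp_rw [integral_mul_const]

/-- The fundamental theorem of calculus along segments, for weak derivatives. -/
theorem ae_translate_sub_eq {Ω : Set E} (hΩ : IsOpen Ω) {z : E} {u g : E → ℝ}
    (hu : Integrable u μ) (hgm : Measurable g) (hg : Integrable g μ)
    (h : HasWeakDirDeriv μ Ω z u g) :
    ∀ᵐ x ∂μ, x ∈ core Ω (segment ℝ 0 z) →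
      u (x + z) - u x = ∫ t in Set.Ioc (0 : ℝ) 1, g (x + t • z) := by
  have hi1 : Integrable (fun x => u (x + z) - u x) μ := (hu.comp_add_right z).sub hu
  have hi2 : Integrable (fun x => ∫ t in Set.Ioc (0 : ℝ) 1, g (x + t • z)) μ :=
    (integrable_prod_translate hgm hg z).integral_prod_left
  have := (isOpen_core hΩ (isCompact_segment_zero z)).ae_eq_zero_of_integral_contDiff_smul_eq_zero
    (μ := μ) (f := fun x => (u (x + z) - u x) - ∫ t in Set.Ioc (0 : ℝ) 1, g (x + t • z))
    ((hi1.sub hi2).locallyIntegrable.locallyIntegrableOn _) (by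
      intro φ h1 h2 h3
      obtain ⟨C, hC⟩ := h1.continuous.bounded_above_of_compact_support h2
      have hb {v : E → ℝ} (hv : Integrable v μ) : Integrable (fun x => v x * φ x) μ :=
        hv.mul_bdd (c := C) h1.continuous.aestronglyMeasurable (Eventually.of_forall hC)
      simp_rw [smul_eq_mul, mul_comm (φ _), sub_mul _ _ (φ _)]
      have e := integral_mul_translate_sub hu hgm hg h h1 h2 h3
      simp_rw [sub_mul] at e
      have hb1 := hb hi1
      simp_rw [sub_mul] at hb1
      rw [integral_sub hb1 (hb hi2), e, sub_self])
  filter_upwards [this] with x hx hxU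
  exact sub_eq_zero.1 (hx hxU)

theorem lintegral_lintegral_translate (g : E → ENNReal) (hg : Measurable g) (z : E) :
    ∫⁻ x, (∫⁻ t in Set.Ioc (0 : ℝ) 1, g (x + t • z)) ∂μ = ∫⁻ x, g x ∂μ := by
  have hm : Measurable fun p : E × ℝ => p.1 + p.2 • z :=
    (by fun_prop : Continuous fun p : E × ℝ => p.1 + p.2 • z).measurable
  rw [lintegral_lintegral_swap (f := fun x (t : ℝ) => g (x + t • z)) (hg.comp hm).aemeasurable]
  simp_rw [lintegral_add_right_eq_self]
  simp

/-- The increment is an average of translates of g along the segment, and Tonelli with translation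
invariance gives each of them the same mass. -/
theorem lintegral_enorm_translate_sub_le {Ω : Set E} (hΩ : IsOpen Ω) {z : E} {u g : E → ℝ}
    (hu : Integrable u μ) (hgm : Measurable g) (hg : Integrable g μ)
    (h : HasWeakDirDeriv μ Ω z u g) :
    ∫⁻ x in core Ω (segment ℝ 0 z), ‖u (x + z) - u x‖ₑ ∂μ ≤ ∫⁻ x, ‖g x‖ₑ ∂μ := by
  have hUm := (isOpen_core hΩ (isCompact_segment_zero z)).measurableSet
  rw [← lintegral_lintegral_translate _ hgm.enorm z]
  refine le_trans ?_ (setLIntegral_le_lintegral (core Ω (segment ℝ 0 z)) _)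
  refine setLIntegral_mono_ae' hUm ?_
  filter_upwards [ae_translate_sub_eq hΩ hu hgm hg h] with x hx hxU
  rw [hx hxU]
  exact enorm_integral_le_lintegral_enorm _

/-- Taylor's formula in integrated form: g(x) is the increment of u minus the mean of g(x + t z) -
g(x) over t in (0, 1]. The increment costs 2 ‖u‖₁, and the increments of g are controlled by its own
derivative `g₂`. -/
theorem lintegral_enorm_le_of_second_deriv {Ω : Set E} (hΩ : IsOpen Ω) {z : E} {u g g₂ : E → ℝ}
    (hu : Integrable u μ) (hum : Measurable u) (hgm : Measurable g) (hg : Integrable g μ)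
    (hgm₂ : Measurable g₂) (hg₂ : Integrable g₂ μ)
    (h : HasWeakDirDeriv μ Ω z u g) (h₂ : HasWeakDirDeriv μ Ω z g g₂) :
    ∫⁻ x in core Ω (segment ℝ 0 z), ‖g x‖ₑ ∂μ ≤ 2 * ∫⁻ x, ‖u x‖ₑ ∂μ + ∫⁻ x, ‖g₂ x‖ₑ ∂μ := by
  set U := core Ω (segment ℝ 0 z) with hU
  have hUm : MeasurableSet U := (isOpen_core hΩ (isCompact_segment_zero z)).measurableSet
  have hm : Measurable fun p : E × ℝ => p.1 + p.2 • z :=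
    (by fun_prop : Continuous fun p : E × ℝ => p.1 + p.2 • z).measurable
  have hmeas : Measurable fun p : E × ℝ => ‖g (p.1 + p.2 • z) - g p.1‖ₑ :=
    ((hgm.comp hm).sub (hgm.comp measurable_fst)).enorm
  have hpt : ∀ᵐ x ∂μ, x ∈ U → ‖g x‖ₑ ≤ ‖u (x + z)‖ₑ + ‖u x‖ₑ +
      ∫⁻ t in Set.Ioc (0 : ℝ) 1, ‖g (x + t • z) - g x‖ₑ := by
    filter_upwards [ae_translate_sub_eq hΩ hu hgm hg h,
      (integrable_prod_translate hgm hg z).prod_right_ae] with x hx hxi hxU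
    have e : g x = (u (x + z) - u x) - ∫ t in Set.Ioc (0 : ℝ) 1, (g (x + t • z) - g x) := by
      rw [hx hxU, integral_sub hxi (integrable_const _)]
      simp
    calc ‖g x‖ₑ ≤ ‖u (x + z) - u x‖ₑ + ‖∫ t in Set.Ioc (0 : ℝ) 1, (g (x + t • z) - g x)‖ₑ := by
          conv_lhs => rw [e]
          exact enorm_sub_le
      _ ≤ _ := add_le_add enorm_sub_le (enorm_integral_le_lintegral_enorm _)
  have hdiff (t : ℝ) (ht : t ∈ Set.Ioc (0 : ℝ) 1) :
      ∫⁻ x in U, ‖g (x + t • z) - g x‖ₑ ∂μ ≤ ∫⁻ x, ‖g₂ x‖ₑ ∂μ := by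
    have hsub : U ⊆ core Ω (segment ℝ 0 (t • z)) := by
      refine core_anti ?_
      exact (convex_segment 0 z).segment_subset (left_mem_segment ℝ 0 z)
        (smul_mem_segment_zero z ⟨ht.1.le, ht.2⟩)
    refine (lintegral_mono_set hsub).trans ?_
    refine (lintegral_enorm_translate_sub_le hΩ hg (hgm₂.const_mul t) (hg₂.const_mul t)
      (h₂.smul t)).trans (lintegral_mono fun x => ?_)
    rw [enorm_mul]
    refine mul_le_of_le_one_left (by positivity) ?_
    rw [Real.enorm_eq_ofReal ht.1.le]
    exact ENNReal.ofReal_le_one.2 ht.2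
  calc ∫⁻ x in U, ‖g x‖ₑ ∂μ ≤ ∫⁻ x in U, (‖u (x + z)‖ₑ + ‖u x‖ₑ +
      ∫⁻ t in Set.Ioc (0 : ℝ) 1, ‖g (x + t • z) - g x‖ₑ) ∂μ := setLIntegral_mono_ae' hUm hpt
    _ = ∫⁻ x in U, ‖u (x + z)‖ₑ ∂μ + ∫⁻ x in U, ‖u x‖ₑ ∂μ +
        ∫⁻ x in U, (∫⁻ t in Set.Ioc (0 : ℝ) 1, ‖g (x + t • z) - g x‖ₑ) ∂μ := by
      have hum' : Measurable fun x => ‖u (x + z)‖ₑ := (hum.comp (measurable_add_const z)).enorm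
      rw [← lintegral_add_left hum', ← lintegral_add_left]
      exact hum'.add hum.enorm
    _ ≤ ∫⁻ x, ‖u x‖ₑ ∂μ + ∫⁻ x, ‖u x‖ₑ ∂μ + ∫⁻ x, ‖g₂ x‖ₑ ∂μ := by
      refine add_le_add (add_le_add ?_ (setLIntegral_le_lintegral _ _)) ?_
      · refine (setLIntegral_le_lintegral _ _).trans (le_of_eq ?_)
        exact lintegral_add_right_eq_self (fun x => ‖u x‖ₑ) z
      · rw [lintegral_lintegral_swap hmeas.aemeasurable]
        refine (setLIntegral_mono' measurableSet_Ioc hdiff).trans ?_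
        simp
    _ = _ := by rw [two_mul]

end Translation

/-! ### Finitely many directions from the cone condition -/

section Cone

/-- The convex hull of the origin and a closed ball. -/
def ballCone {E : Type*} [NormedAddCommGroup E] [NormedSpace ℝ E] (w : E) (η : ℝ) : Set E :=
  (fun p : ℝ × E => p.1 • p.2) '' (Set.Icc 0 1 ×ˢ Metric.closedBall w η)

theorem segment_subset_ballCone {E : Type*} [NormedAddCommGroup E] [NormedSpace ℝ E] {w y : E}
    {η h : ℝ} (hy : y ∈ Metric.closedBall w η) (h0 : 0 ≤ h) (h1 : h ≤ 1) :
    segment ℝ 0 (h • y) ⊆ ballCone w η := by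
  rw [segment_eq_image]
  rintro _ ⟨t, ht, rfl⟩
  refine ⟨(t * h, y), ⟨⟨mul_nonneg ht.1 h0, mul_le_one₀ ht.2 h0 h1⟩, hy⟩, ?_⟩
  simp [mul_smul]

/-- Expanding the square gives 2⟨y, v⟩ ≥ ‖y‖² + cos² θ ≥ 2 ‖y‖ cos θ. -/
theorem angle_le_of_norm_sub_le_sin {V : Type*} [NormedAddCommGroup V] [InnerProductSpace ℝ V]
    {y v : V} {θ : ℝ} (hθ : 0 ≤ θ) (hθ' : θ ≤ Real.pi / 2) (hv : ‖v‖ = 1) (hy : y ≠ 0)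
    (h : ‖y - v‖ ≤ Real.sin θ) : InnerProductGeometry.angle y v ≤ θ := by
  have hpi := Real.pi_pos
  rw [InnerProductGeometry.angle, ← Real.arccos_cos hθ (by linarith)]
  refine Real.arccos_le_arccos ?_
  have hy0 : 0 < ‖y‖ := norm_pos_iff.2 hy
  rw [hv, mul_one, le_div_iff₀ hy0]
  have h1 := norm_sub_sq_real y v
  have h2 : ‖y - v‖ ^ 2 ≤ Real.sin θ ^ 2 := pow_le_pow_left₀ (norm_nonneg _) h 2
  have h3 := Real.sin_sq_add_cos_sq θ
  rw [hv] at h1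
  nlinarith [sq_nonneg (‖y‖ - Real.cos θ)]

variable {d : ℕ}

/-- The axis of the cone depends on x without any regularity. A finite net on the unit sphere, fine
compared with sin(κ/2), replaces it by finitely many directions, at the price of a narrower cone. -/
theorem exists_finite_directions {Ω : Set (EuclideanSpace ℝ (Fin d))} (h : ConeCondition Ω) :
    ∃ (W : Finset (EuclideanSpace ℝ (Fin d))) (η : ℝ), 0 < η ∧
      ∀ x ∈ Ω, ∃ w ∈ W, x ∈ core Ω (ballCone w η) := by
  obtain ⟨ρ, κ, hρ, hκ, hκπ, hcone⟩ := h
  have hs : 0 < Real.sin (κ / 2) :=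
    Real.sin_pos_of_pos_of_lt_pi (by positivity) (by linarith [Real.pi_pos])
  set s := Real.sin (κ / 2) with hsdef
  have hs1 : s ≤ 1 := Real.sin_le_one _
  obtain ⟨T, hT, hTfin, hTcov⟩ := (isCompact_sphere (0 : EuclideanSpace ℝ (Fin d)) 1).finite_cover_balls
    (half_pos hs)
  -- After rescaling by c, points of the ball are within s ≤ 1 of a unit vector, so they have norm
  -- at most 2 and c = ρ / 2 keeps them at height at most ρ.
  set c : ℝ := ρ / 2 with hc
  have hc0 : 0 < c := by positivity
  classical
  refine ⟨hTfin.toFinset.image (fun w => c • w), c * (s / 2), by positivity, fun x hx => ?_⟩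
  obtain ⟨v, hv, hcv⟩ := hcone x hx
  have hv0 : 0 < ‖v‖ := norm_pos_iff.2 hv
  set v' := ‖v‖⁻¹ • v with hv'
  have hv'1 : ‖v'‖ = 1 := norm_smul_inv_norm hv
  obtain ⟨w, hw, hvw⟩ := Set.mem_iUnion₂.1 (hTcov (by simpa using hv'1 : v' ∈ Metric.sphere 0 1))
  refine ⟨c • w, Finset.mem_image_of_mem _ (hTfin.mem_toFinset.2 hw), ?_⟩
  rintro _ ⟨⟨t, y⟩, ⟨ht, hy⟩, rfl⟩
  simp only at ht hy ⊢
  apply hcv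
  set y' := c⁻¹ • y with hy'
  have hyy' : y = c • y' := by rw [hy', smul_inv_smul₀ hc0.ne']
  have hyw : ‖y' - w‖ ≤ s / 2 := by
    rw [Metric.mem_closedBall, dist_eq_norm, hyy', ← smul_sub, norm_smul, Real.norm_eq_abs,
      abs_of_pos hc0] at hy
    exact le_of_mul_le_mul_left hy hc0
  have hyv : ‖y' - v'‖ ≤ s := by
    have h1 := norm_sub_le_norm_sub_add_norm_sub y' w v'
    rw [Metric.mem_ball, dist_eq_norm, norm_sub_rev] at hvw
    linarith
  by_cases hz : t • y = 0
  · left; rw [hz, add_zero]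
  · right
    rw [add_sub_cancel_left]
    have ht0 : 0 < t := lt_of_le_of_ne ht.1 (fun h => hz (by rw [← h, zero_smul]))
    have hy0 : y' ≠ 0 := fun h => hz (by rw [hyy', h, smul_zero, smul_zero])
    refine ⟨norm_pos_iff.2 hz, ?_, ?_⟩
    · have h2 : ‖y'‖ ≤ 2 := by
        have := norm_le_norm_add_norm_sub' y' v'
        linarith
      rw [hyy', smul_smul, norm_smul, Real.norm_eq_abs, abs_of_pos (by positivity)]
      calc t * c * ‖y'‖ ≤ 1 * c * 2 := by gcongr; exact ht.2
        _ = ρ := by rw [hc]; ring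
    · have hvv : v = ‖v‖ • v' := by rw [hv', smul_inv_smul₀ hv0.ne']
      rw [hyy', smul_smul, InnerProductGeometry.angle_smul_left_of_pos _ _ (by positivity), hvv,
        InnerProductGeometry.angle_smul_right_of_pos _ _ hv0]
      exact angle_le_of_norm_sub_le_sin (by positivity) (by linarith) hv'1 hy0 hyv

end Cone

/-! ### Local estimates in a fixed cone direction -/

section Gradient

variable {d : ℕ}

/-- The functions `v i` are the integrable weak partial derivatives of the integrable function `u`
on `Ω`. -/
structure IsWeakGradient (Ω : Set (EuclideanSpace ℝ (Fin d)))
    (u : EuclideanSpace ℝ (Fin d) → ℝ) (v : Fin d → EuclideanSpace ℝ (Fin d) → ℝ) : Prop where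
  measurable : Measurable u
  integrable : Integrable u
  measurable_grad : ∀ i, Measurable (v i)
  integrable_grad : ∀ i, Integrable (v i)
  hasWeakDirDeriv : ∀ i, HasWeakDirDeriv volume Ω (EuclideanSpace.single i 1) u (v i)

variable {Ω : Set (EuclideanSpace ℝ (Fin d))} {u : EuclideanSpace ℝ (Fin d) → ℝ}
  {v : Fin d → EuclideanSpace ℝ (Fin d) → ℝ}

/-- The derivative in the direction `y` of a function with gradient `v`. -/
def dirDeriv (v : Fin d → EuclideanSpace ℝ (Fin d) → ℝ) (y : EuclideanSpace ℝ (Fin d)) :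
    EuclideanSpace ℝ (Fin d) → ℝ := fun x => ∑ i, y i * v i x

theorem IsWeakGradient.measurable_dirDeriv (h : IsWeakGradient Ω u v)
    (y : EuclideanSpace ℝ (Fin d)) : Measurable (dirDeriv v y) :=
  Finset.measurable_fun_sum _ fun i _ => (h.measurable_grad i).const_mul _

theorem IsWeakGradient.integrable_dirDeriv (h : IsWeakGradient Ω u v)
    (y : EuclideanSpace ℝ (Fin d)) : Integrable (dirDeriv v y) :=
  integrable_finsetSum _ fun i _ => (h.integrable_grad i).const_mul _

theorem IsWeakGradient.dirDeriv (h : IsWeakGradient Ω u v) (y : EuclideanSpace ℝ (Fin d)) :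
    HasWeakDirDeriv volume Ω y u (dirDeriv v y) := by
  intro φ h1 h2 h3
  obtain ⟨C, hC⟩ := h1.continuous.bounded_above_of_compact_support h2
  have hb {w : EuclideanSpace ℝ (Fin d) → ℝ} (hw : Integrable w) :
      Integrable (fun x => w x * φ x) :=
    hw.mul_bdd (c := C) h1.continuous.aestronglyMeasurable (Eventually.of_forall hC)
  have hb' (i : Fin d) : Integrable (fun x => u x * fderiv ℝ φ x (EuclideanSpace.single i 1)) := by
    have hφ' : Continuous fun x => fderiv ℝ φ x (EuclideanSpace.single i 1) :=
      (h1.continuous_fderiv (by simp)).clm_apply continuous_const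
    obtain ⟨C', hC'⟩ := hφ'.bounded_above_of_compact_support (h2.fderiv_apply (𝕜 := ℝ) _)
    exact h.integrable.mul_bdd (c := C') hφ'.aestronglyMeasurable (Eventually.of_forall hC')
  have hy : y = ∑ i, y i • EuclideanSpace.single i (1 : ℝ) := by
    ext j
    simp [Finset.sum_apply, Pi.single_apply]
  have e1 (x : EuclideanSpace ℝ (Fin d)) : u x * fderiv ℝ φ x y =
      ∑ i, y i * (u x * fderiv ℝ φ x (EuclideanSpace.single i 1)) := by
    conv_lhs => rw [hy]
    rw [map_sum, Finset.mul_sum]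
    refine Finset.sum_congr rfl fun i _ => ?_
    rw [map_smul, smul_eq_mul]
    ring
  simp_rw [e1, Sobolev.dirDeriv, Finset.sum_mul, mul_assoc]
  rw [integral_finsetSum _ fun i _ => (hb' i).const_mul _,
    integral_finsetSum _ fun i _ => (hb (h.integrable_grad i)).const_mul _, ← Finset.sum_neg_distrib]
  refine Finset.sum_congr rfl fun i _ => ?_
  rw [integral_const_mul, integral_const_mul, h.hasWeakDirDeriv i φ h1 h2 h3, mul_neg]

theorem lintegral_enorm_dirDeriv_le (hv : ∀ i, Measurable (v i)) (y : EuclideanSpace ℝ (Fin d)) :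
    ∫⁻ x, ‖dirDeriv v y x‖ₑ ≤ ‖y‖ₑ * ∑ i, ∫⁻ x, ‖v i x‖ₑ := by
  rw [← lintegral_finsetSum _ fun i _ => (hv i).enorm,
    ← lintegral_const_mul _ (Finset.measurable_fun_sum _ fun i _ => (hv i).enorm)]
  refine lintegral_mono fun x => ?_
  refine (enorm_sum_le _ _).trans ?_
  rw [Finset.mul_sum]
  refine Finset.sum_le_sum fun i _ => ?_
  rw [enorm_mul]
  gcongr
  rw [enorm_le_iff_norm_le]
  exact PiLp.norm_apply_le y i

theorem dirDeriv_smul (t : ℝ) (y : EuclideanSpace ℝ (Fin d)) :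
    dirDeriv v (t • y) = fun x => t * dirDeriv v y x := by
  ext x
  simp [dirDeriv, Finset.mul_sum, mul_assoc]

/-- The bound |u(x)| ≤ |u(x+z)| + |u(x+z) - u(x)| is integrated over z in a small ball. In the first
term, integrating over z before x replaces the concentration of u on A by λ(A) ‖u‖₁; the second is
of order h times the gradient. -/
theorem mul_lintegral_core_le (hΩ : IsOpen Ω) (w : EuclideanSpace ℝ (Fin d)) {η h : ℝ}
    (h0 : 0 < h) (h1 : h ≤ 1) (huv : IsWeakGradient Ω u v)
    (A : Set (EuclideanSpace ℝ (Fin d))) :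
    volume (Metric.closedBall (h • w) (h * η)) *
        ∫⁻ x in A ∩ core Ω (ballCone w η), ‖u x‖ₑ ≤
      volume A * (∫⁻ x, ‖u x‖ₑ) + volume (Metric.closedBall (h • w) (h * η)) *
        (ENNReal.ofReal (h * (‖w‖ + η)) * ∑ i, ∫⁻ x, ‖v i x‖ₑ) := by
  set B := Metric.closedBall (h • w) (h * η) with hB
  set U := A ∩ core Ω (ballCone w η) with hU
  have hz (z : EuclideanSpace ℝ (Fin d)) (hzB : z ∈ B) : ∫⁻ x in U, ‖u x‖ₑ ≤
      (∫⁻ x in U, ‖u (x + z)‖ₑ) + ENNReal.ofReal (h * (‖w‖ + η)) * ∑ i, ∫⁻ x, ‖v i x‖ₑ := by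
    have hy : h⁻¹ • z ∈ Metric.closedBall w η := by
      rw [hB, Metric.mem_closedBall, dist_eq_norm] at hzB
      rw [Metric.mem_closedBall, dist_eq_norm]
      have : h⁻¹ • z - w = h⁻¹ • (z - h • w) := by rw [smul_sub, inv_smul_smul₀ h0.ne']
      rw [this, norm_smul, Real.norm_eq_abs, abs_of_pos (by positivity), inv_mul_le_iff₀ h0]
      exact hzB
    have hsub : U ⊆ core Ω (segment ℝ 0 z) := by
      refine Set.inter_subset_right.trans (core_anti ?_)
      have := segment_subset_ballCone hy h0.le h1
      rwa [smul_inv_smul₀ h0.ne'] at this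
    have hm : Measurable fun x => ‖u (x + z)‖ₑ :=
      (huv.measurable.comp (measurable_add_const z)).enorm
    calc ∫⁻ x in U, ‖u x‖ₑ ≤ ∫⁻ x in U, (‖u (x + z)‖ₑ + ‖u (x + z) - u x‖ₑ) := by
          refine lintegral_mono fun x => ?_
          have : u x = u (x + z) - (u (x + z) - u x) := by ring
          conv_lhs => rw [this]
          exact enorm_sub_le
      _ = (∫⁻ x in U, ‖u (x + z)‖ₑ) + ∫⁻ x in U, ‖u (x + z) - u x‖ₑ := lintegral_add_left hm _
      _ ≤ _ := by
        gcongr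
        refine (lintegral_mono_set hsub).trans ?_
        refine (lintegral_enorm_translate_sub_le hΩ huv.integrable (huv.measurable_dirDeriv z)
          (huv.integrable_dirDeriv z) (huv.dirDeriv z)).trans ?_
        refine (lintegral_enorm_dirDeriv_le huv.measurable_grad z).trans ?_
        gcongr
        rw [← ofReal_norm]
        refine ENNReal.ofReal_le_ofReal ?_
        rw [hB, Metric.mem_closedBall, dist_eq_norm] at hzB
        have := norm_le_norm_add_norm_sub' z (h • w)
        rw [norm_smul, Real.norm_eq_abs, abs_of_pos h0] at this
        linarith
  have hBm : MeasurableSet B := measurableSet_closedBall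
  have hmm : Measurable fun p : EuclideanSpace ℝ (Fin d) × EuclideanSpace ℝ (Fin d) =>
      ‖u (p.2 + p.1)‖ₑ :=
    (huv.measurable.comp (measurable_snd.add measurable_fst)).enorm
  calc volume B * ∫⁻ x in U, ‖u x‖ₑ = ∫⁻ z in B, (∫⁻ x in U, ‖u x‖ₑ) := by
        rw [setLIntegral_const, mul_comm]
    _ ≤ ∫⁻ z in B, ((∫⁻ x in U, ‖u (x + z)‖ₑ) +
          ENNReal.ofReal (h * (‖w‖ + η)) * ∑ i, ∫⁻ x, ‖v i x‖ₑ) := setLIntegral_mono' hBm hz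
    _ = (∫⁻ z in B, ∫⁻ x in U, ‖u (x + z)‖ₑ) +
          volume B * (ENNReal.ofReal (h * (‖w‖ + η)) * ∑ i, ∫⁻ x, ‖v i x‖ₑ) := by
        rw [lintegral_add_right _ measurable_const, setLIntegral_const, mul_comm (volume B)]
    _ ≤ _ := by
        gcongr
        rw [lintegral_lintegral_swap hmm.aemeasurable]
        calc ∫⁻ x in U, ∫⁻ z in B, ‖u (x + z)‖ₑ ≤ ∫⁻ x in U, ∫⁻ z, ‖u z‖ₑ := by
              refine lintegral_mono fun x => ?_
              refine (setLIntegral_le_lintegral _ _).trans (le_of_eq ?_)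
              exact lintegral_add_left_eq_self (fun z => ‖u z‖ₑ) x
          _ = volume U * ∫⁻ z, ‖u z‖ₑ := by rw [setLIntegral_const, mul_comm]
          _ ≤ _ := by gcongr; exact Set.inter_subset_left

/-- The second-order estimate controls only derivatives along steps that stay in Ω. Both w and w + η
e_i are admissible directions, and the difference of the two directional derivatives is η ∂_i u. -/
theorem mul_lintegral_grad_core_le (hΩ : IsOpen Ω) (w : EuclideanSpace ℝ (Fin d)) {η h : ℝ}
    (hη : 0 < η) (h0 : 0 < h) (h1 : h ≤ 1) (huv : IsWeakGradient Ω u v)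
    {vv : Fin d → Fin d → EuclideanSpace ℝ (Fin d) → ℝ}
    (hvv : ∀ i, IsWeakGradient Ω (v i) (vv i)) (i : Fin d) :
    ENNReal.ofReal (h * η) * ∫⁻ x in core Ω (ballCone w η), ‖v i x‖ₑ ≤
      4 * (∫⁻ x, ‖u x‖ₑ) + 2 * ENNReal.ofReal ((h * (‖w‖ + η)) ^ 2) *
        ∑ j, ∑ l, ∫⁻ x, ‖vv j l x‖ₑ := by
  set U := core Ω (ballCone w η) with hU
  have hgrad (y : EuclideanSpace ℝ (Fin d)) :
      IsWeakGradient Ω (dirDeriv v y) (fun l => dirDeriv (fun j => vv j l) y) := by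
    refine ⟨huv.measurable_dirDeriv y, huv.integrable_dirDeriv y, fun l => ?_, fun l => ?_,
      fun l => ?_⟩
    · exact Finset.measurable_fun_sum _ fun j _ => ((hvv j).measurable_grad l).const_mul _
    · exact integrable_finsetSum _ fun j _ => ((hvv j).integrable_grad l).const_mul _
    · intro φ h1 h2 h3
      obtain ⟨C, hC⟩ := h1.continuous.bounded_above_of_compact_support h2
      have hb {w : EuclideanSpace ℝ (Fin d) → ℝ} (hw : Integrable w) :
          Integrable (fun x => w x * φ x) :=
        hw.mul_bdd (c := C) h1.continuous.aestronglyMeasurable (Eventually.of_forall hC)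
      have hφ' : Continuous fun x => fderiv ℝ φ x (EuclideanSpace.single l 1) :=
        (h1.continuous_fderiv (by simp)).clm_apply continuous_const
      obtain ⟨C', hC'⟩ := hφ'.bounded_above_of_compact_support (h2.fderiv_apply (𝕜 := ℝ) _)
      have hb' {w : EuclideanSpace ℝ (Fin d) → ℝ} (hw : Integrable w) :
          Integrable (fun x => w x * fderiv ℝ φ x (EuclideanSpace.single l 1)) :=
        hw.mul_bdd (c := C') hφ'.aestronglyMeasurable (Eventually.of_forall hC')
      simp_rw [dirDeriv, Finset.sum_mul, mul_assoc]
      rw [integral_finsetSum _ fun j _ => (hb' (huv.integrable_grad j)).const_mul _,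
        integral_finsetSum _ fun j _ => (hb ((hvv j).integrable_grad l)).const_mul _,
        ← Finset.sum_neg_distrib]
      refine Finset.sum_congr rfl fun j _ => ?_
      rw [integral_const_mul, integral_const_mul, (hvv j).hasWeakDirDeriv l φ h1 h2 h3, mul_neg]
  have hy (y : EuclideanSpace ℝ (Fin d)) (hyB : y ∈ Metric.closedBall w η) :
      ENNReal.ofReal h * ∫⁻ x in U, ‖dirDeriv v y x‖ₑ ≤ 2 * (∫⁻ x, ‖u x‖ₑ) +
        ENNReal.ofReal ((h * (‖w‖ + η)) ^ 2) * ∑ j, ∑ l, ∫⁻ x, ‖vv j l x‖ₑ := by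
    have hsub : U ⊆ core Ω (segment ℝ 0 (h • y)) :=
      core_anti (segment_subset_ballCone hyB h0.le h1)
    have hg := hgrad (h • y)
    have key := lintegral_enorm_le_of_second_deriv hΩ huv.integrable huv.measurable
      (huv.measurable_dirDeriv (h • y)) (huv.integrable_dirDeriv (h • y))
      (hg.measurable_dirDeriv (h • y)) (hg.integrable_dirDeriv (h • y))
      (huv.dirDeriv (h • y)) (hg.dirDeriv (h • y))
    have e1 : ENNReal.ofReal h * ∫⁻ x in U, ‖dirDeriv v y x‖ₑ =
        ∫⁻ x in U, ‖dirDeriv v (h • y) x‖ₑ := by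
      rw [← lintegral_const_mul _ (huv.measurable_dirDeriv y).enorm]
      simp_rw [dirDeriv_smul, enorm_mul, Real.enorm_eq_ofReal h0.le]
    have hyn : ‖h • y‖ₑ ≤ ENNReal.ofReal (h * (‖w‖ + η)) := by
      rw [← ofReal_norm]
      refine ENNReal.ofReal_le_ofReal ?_
      rw [norm_smul, Real.norm_eq_abs, abs_of_pos h0]
      rw [Metric.mem_closedBall, dist_eq_norm] at hyB
      have := norm_le_norm_add_norm_sub' y w
      gcongr
      linarith
    have e2 : ∫⁻ x, ‖dirDeriv (fun l => dirDeriv (fun j => vv j l) (h • y)) (h • y) x‖ₑ ≤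
        ENNReal.ofReal ((h * (‖w‖ + η)) ^ 2) * ∑ j, ∑ l, ∫⁻ x, ‖vv j l x‖ₑ := by
      refine (lintegral_enorm_dirDeriv_le hg.measurable_grad _).trans ?_
      rw [ENNReal.ofReal_pow (by positivity), pow_two, mul_assoc, Finset.sum_comm,
        Finset.mul_sum (a := ENNReal.ofReal (h * (‖w‖ + η)))]
      refine mul_le_mul' hyn (Finset.sum_le_sum fun l _ => ?_)
      exact (lintegral_enorm_dirDeriv_le (fun j => (hvv j).measurable_grad l) _).trans
        (mul_le_mul' hyn le_rfl)
    rw [e1]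
    exact (lintegral_mono_set hsub).trans (key.trans (by gcongr))
  have hw1 := hy w (Metric.mem_closedBall_self hη.le)
  have hw2 := hy (w + η • EuclideanSpace.single i 1) (by
    rw [Metric.mem_closedBall, dist_eq_norm, add_sub_cancel_left, norm_smul]
    simp [abs_of_pos hη])
  have hpt (x : EuclideanSpace ℝ (Fin d)) : ENNReal.ofReal η * ‖v i x‖ₑ ≤
      ‖dirDeriv v (w + η • EuclideanSpace.single i 1) x‖ₑ + ‖dirDeriv v w x‖ₑ := by
    have e : η * v i x = dirDeriv v (w + η • EuclideanSpace.single i 1) x - dirDeriv v w x := by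
      simp [dirDeriv, add_mul, Finset.sum_add_distrib]
    rw [← Real.enorm_eq_ofReal hη.le, ← enorm_mul, e]
    exact enorm_sub_le
  calc ENNReal.ofReal (h * η) * ∫⁻ x in U, ‖v i x‖ₑ
      = ENNReal.ofReal h * ∫⁻ x in U, ENNReal.ofReal η * ‖v i x‖ₑ := by
        rw [lintegral_const_mul _ (huv.measurable_grad i).enorm, ENNReal.ofReal_mul h0.le, mul_assoc]
    _ ≤ ENNReal.ofReal h * ∫⁻ x in U, (‖dirDeriv v (w + η • EuclideanSpace.single i 1) x‖ₑ +
          ‖dirDeriv v w x‖ₑ) := by gcongr with x; exact hpt x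
    _ = ENNReal.ofReal h * (∫⁻ x in U, ‖dirDeriv v (w + η • EuclideanSpace.single i 1) x‖ₑ) +
        ENNReal.ofReal h * ∫⁻ x in U, ‖dirDeriv v w x‖ₑ := by
        rw [lintegral_add_left (huv.measurable_dirDeriv _).enorm, mul_add]
    _ ≤ _ := (add_le_add hw2 hw1).trans (le_of_eq (by ring))

end Gradient

/-! ### Lower-order derivatives on a domain with the cone condition -/

variable {d : ℕ} {Ω : Opens (EuclideanSpace ℝ (Fin d))} {k : ℕ}

/-- The extension by zero of a function in `L¹(Ω)`. -/
noncomputable def zeroExt (f : L1 Ω) : EuclideanSpace ℝ (Fin d) → ℝ :=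
  (Ω : Set (EuclideanSpace ℝ (Fin d))).indicator f

theorem measurable_zeroExt (f : L1 Ω) : Measurable (zeroExt f) :=
  (Lp.stronglyMeasurable f).measurable.indicator Ω.isOpen.measurableSet

theorem integrable_zeroExt (f : L1 Ω) : Integrable (zeroExt f) :=
  (integrable_indicator_iff Ω.isOpen.measurableSet).2 (L1.integrable_coeFn f)

theorem lintegral_enorm_L1 (f : L1 Ω) :
    ∫⁻ x in (Ω : Set (EuclideanSpace ℝ (Fin d))), ‖f x‖ₑ = ENNReal.ofReal ‖f‖ := by
  rw [L1.norm_eq_integral_norm, ofReal_integral_norm_eq_lintegral_enorm (L1.integrable_coeFn f)]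

theorem lintegral_enorm_zeroExt (f : L1 Ω) : ∫⁻ x, ‖zeroExt f x‖ₑ = ENNReal.ofReal ‖f‖ := by
  rw [← lintegral_enorm_L1, ← lintegral_indicator Ω.isOpen.measurableSet]
  simp_rw [zeroExt, enorm_indicator_eq_indicator_enorm]

theorem setLIntegral_enorm_zeroExt (f : L1 Ω) {A : Set (EuclideanSpace ℝ (Fin d))}
    (hA : A ⊆ Ω) : ∫⁻ x in A, ‖zeroExt f x‖ₑ = ∫⁻ x in A, ‖f x‖ₑ := by
  simp_rw [zeroExt, enorm_indicator_eq_indicator_enorm]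
  rw [setLIntegral_indicator Ω.isOpen.measurableSet, Set.inter_eq_self_of_subset_right hA]

theorem integral_zeroExt_mul (f : L1 Ω) (ψ : EuclideanSpace ℝ (Fin d) → ℝ) :
    ∫ x, zeroExt f x * ψ x = ∫ x in (Ω : Set (EuclideanSpace ℝ (Fin d))), f x * ψ x := by
  rw [← integral_indicator Ω.isOpen.measurableSet]
  simp_rw [zeroExt, Set.indicator_mul_left]

theorem isWeakGradient_zeroExt (f : SobolevSpace Ω k) {α : Fin d → ℕ} (hα : ∑ j, α j + 1 ≤ k) :
    IsWeakGradient (Ω : Set (EuclideanSpace ℝ (Fin d))) (zeroExt (f.D α))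
      (fun i => zeroExt (f.D (α + Pi.single i 1))) where
  measurable := measurable_zeroExt _
  integrable := integrable_zeroExt _
  measurable_grad _ := measurable_zeroExt _
  integrable_grad _ := integrable_zeroExt _
  hasWeakDirDeriv i φ h1 h2 h3 := by
    rw [integral_zeroExt_mul, integral_zeroExt_mul]
    exact integral_D_mul_pderiv f hα i h1 h2 h3

theorem norm_D_le (f : SobolevSpace Ω k) {α : Fin d → ℕ} (hα : ∑ j, α j ≤ k) :
    ‖f.D α‖ ≤ ‖f‖ := by
  rw [SobolevSpace.norm_def]
  exact Finset.single_le_sum (f := fun α => ‖f.D α‖) (fun _ _ => norm_nonneg _)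
    (mem_multiIndexLE.2 hα)

theorem setLIntegral_le_sum_inter {E : Type*} [MeasurableSpace E] {μ : Measure E} {ι : Type*}
    (W : Finset ι) (U : ι → Set E) {A : Set E} (hA : ∀ x ∈ A, ∃ w ∈ W, x ∈ U w)
    (g : E → ENNReal) : ∫⁻ x in A, g x ∂μ ≤ ∑ w ∈ W, ∫⁻ x in A ∩ U w, g x ∂μ := by
  rw [← Finset.sum_coe_sort W fun w => ∫⁻ x in A ∩ U w, g x ∂μ, ← tsum_fintype (L := .unconditional _)]
  refine le_trans (lintegral_mono_set fun x hx => ?_) (lintegral_iUnion_le _ _)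
  obtain ⟨w, hw, hxw⟩ := hA x hx
  exact Set.mem_iUnion.2 ⟨⟨w, hw⟩, hx, hxw⟩

/-- Under the cone condition, the derivatives of non-maximal order of functions in a bounded set of
`W^{k,1}(Ω)` are equi-integrable. -/
theorem exists_forall_setLIntegral_D_le (hcone : ConeCondition (Ω : Set (EuclideanSpace ℝ (Fin d))))
    {M ε : ℝ} (hM : 0 < M) (hε : 0 < ε) :
    ∃ δ > 0, ∀ f : SobolevSpace Ω k, ‖f‖ ≤ M → ∀ α : Fin d → ℕ, ∑ j, α j + 1 ≤ k →
      ∀ A : Set (EuclideanSpace ℝ (Fin d)), A ⊆ Ω → volume A < ENNReal.ofReal δ →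
        ∫⁻ x in A, ‖f.D α x‖ₑ ≤ ENNReal.ofReal ε := by
  obtain ⟨W, η, hη, hW⟩ := exists_finite_directions hcone
  set C : ℝ := ∑ w ∈ W, (‖w‖ + η) * (d * M) with hC
  have hC0 : 0 ≤ C := Finset.sum_nonneg fun w _ => by positivity
  -- First h is fixed so that the gradient terms, summed over W, are at most ε / 2; the cap 1 keeps
  -- the segments inside the cones.
  set h : ℝ := min 1 (ε / (2 * (C + 1))) with hh
  have h0 : 0 < h := lt_min one_pos (by positivity)
  have h1 : h ≤ 1 := min_le_left _ _
  have hhC : h * C ≤ ε / 2 := by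
    have : h ≤ ε / (2 * (C + 1)) := min_le_right _ _
    rw [le_div_iff₀ (by positivity)] at this
    nlinarith
  set m : EuclideanSpace ℝ (Fin d) → ℝ := fun w => volume.real (Metric.closedBall (h • w) (h * η))
  have hm0 (w : EuclideanSpace ℝ (Fin d)) : 0 < m w :=
    ENNReal.toReal_pos (Metric.measure_closedBall_pos _ _ (by positivity)).ne'
      measure_closedBall_lt_top.ne
  have hmv (w : EuclideanSpace ℝ (Fin d)) :
      volume (Metric.closedBall (h • w) (h * η)) = ENNReal.ofReal (m w) :=
    (ENNReal.ofReal_toReal measure_closedBall_lt_top.ne).symm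
  set c : ℝ := ∑ w ∈ W, (m w)⁻¹ * M with hc
  have hc0 : 0 ≤ c := Finset.sum_nonneg fun w _ => mul_nonneg (inv_nonneg.2 (hm0 w).le) hM.le
  -- Only now is the measure of A restricted: c contains the inverse volumes of balls of radius h η,
  -- so it depends on the chosen h.
  refine ⟨ε / (2 * (c + 1)), by positivity, fun f hf α hα A hA hAδ => ?_⟩
  have hgrad := isWeakGradient_zeroExt f hα
  rw [← setLIntegral_enorm_zeroExt _ hA]
  set a := volume.real A with ha
  have hAa : volume A = ENNReal.ofReal a := (ENNReal.ofReal_toReal hAδ.ne_top).symm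
  have ha0 : 0 ≤ a := ENNReal.toReal_nonneg
  have hac : a * c ≤ ε / 2 := by
    have : a < ε / (2 * (c + 1)) := by
      rwa [ENNReal.lt_ofReal_iff_toReal_lt hAδ.ne_top] at hAδ
    rw [lt_div_iff₀ (by positivity)] at this
    nlinarith
  have hw (w : EuclideanSpace ℝ (Fin d)) :
      ∫⁻ x in A ∩ core Ω (ballCone w η), ‖zeroExt (f.D α) x‖ₑ ≤
        ENNReal.ofReal (a * ((m w)⁻¹ * M) + h * ((‖w‖ + η) * (d * M))) := by
    have key := mul_lintegral_core_le Ω.isOpen w (η := η) h0 h1 hgrad A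
    rw [hmv, hAa, lintegral_enorm_zeroExt] at key
    simp_rw [lintegral_enorm_zeroExt] at key
    have hsum : ∑ i : Fin d, ENNReal.ofReal ‖f.D (α + Pi.single i 1)‖ ≤ ENNReal.ofReal (d * M) := by
      rw [← ENNReal.ofReal_sum_of_nonneg fun _ _ => norm_nonneg _]
      refine ENNReal.ofReal_le_ofReal ?_
      have := Finset.sum_le_card_nsmul (Finset.univ : Finset (Fin d))
        (fun i => ‖f.D (α + Pi.single i 1)‖) M fun i _ =>
        (norm_D_le f (by rw [sum_add_single]; exact hα)).trans hf
      simpa using this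
    have hu : ENNReal.ofReal ‖f.D α‖ ≤ ENNReal.ofReal M :=
      ENNReal.ofReal_le_ofReal ((norm_D_le f (by omega)).trans hf)
    have hpos : 0 < ‖w‖ + η := by positivity
    have hmw := hm0 w
    have key2 : ENNReal.ofReal (m w) * ∫⁻ x in A ∩ core Ω (ballCone w η), ‖zeroExt (f.D α) x‖ₑ ≤
        ENNReal.ofReal (m w) *
          ENNReal.ofReal (a * ((m w)⁻¹ * M) + h * ((‖w‖ + η) * (d * M))) := by
      refine key.trans ?_
      calc _ ≤ ENNReal.ofReal a * ENNReal.ofReal M + ENNReal.ofReal (m w) *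
            (ENNReal.ofReal (h * (‖w‖ + η)) * ENNReal.ofReal (d * M)) := by gcongr
        _ = _ := by
          rw [← ENNReal.ofReal_mul ha0, ← ENNReal.ofReal_mul (by positivity),
            ← ENNReal.ofReal_mul (by positivity), ← ENNReal.ofReal_mul (by positivity),
            ← ENNReal.ofReal_add (by positivity) (by positivity)]
          congr 1
          field_simp
    exact (ENNReal.mul_le_mul_iff_right (ENNReal.ofReal_pos.2 hmw).ne' ENNReal.ofReal_ne_top).1 key2
  refine (setLIntegral_le_sum_inter W (fun w => core Ω (ballCone w η))
    (fun x hx => hW x (hA hx)) _).trans ?_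
  refine (Finset.sum_le_sum fun w _ => hw w).trans ?_
  rw [← ENNReal.ofReal_sum_of_nonneg]
  · refine ENNReal.ofReal_le_ofReal ?_
    rw [Finset.sum_add_distrib, ← Finset.mul_sum, ← Finset.mul_sum]
    linarith
  · intro w _
    have := hm0 w
    positivity

/-- The interpolation inequality for first derivatives on a domain with the cone condition. -/
theorem exists_mul_norm_D_le (hcone : ConeCondition (Ω : Set (EuclideanSpace ℝ (Fin d)))) :
    ∃ C : ℝ, 0 ≤ C ∧ ∀ f : SobolevSpace Ω k, ∀ α : Fin d → ℕ, ∑ j, α j + 2 ≤ k → ∀ i : Fin d,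
      ∀ h : ℝ, 0 < h → h ≤ 1 → h * ‖f.D (α + Pi.single i 1)‖ ≤
        C * (‖f.D α‖ + h ^ 2 * ∑ j, ∑ l, ‖f.D (α + Pi.single j 1 + Pi.single l 1)‖) := by
  obtain ⟨W, η, hη, hW⟩ := exists_finite_directions hcone
  set C : ℝ := ∑ w ∈ W, (4 + 2 * (‖w‖ + η) ^ 2) with hC
  refine ⟨C / η, div_nonneg (Finset.sum_nonneg fun w _ => by positivity) hη.le,
    fun f α hα i h h0 h1 => ?_⟩
  set S : ℝ := ∑ j, ∑ l, ‖f.D (α + Pi.single j 1 + Pi.single l 1)‖ with hSdef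
  have hS0 : 0 ≤ S := Finset.sum_nonneg fun j _ => Finset.sum_nonneg fun l _ => norm_nonneg _
  have hgrad := isWeakGradient_zeroExt f (α := α) (by omega)
  have hgrad2 (j : Fin d) := isWeakGradient_zeroExt f (α := α + Pi.single j 1)
    (by rw [sum_add_single]; omega)
  have hw (w : EuclideanSpace ℝ (Fin d)) : ENNReal.ofReal (h * η) *
      ∫⁻ x in (Ω : Set (EuclideanSpace ℝ (Fin d))) ∩ core Ω (ballCone w η),
        ‖zeroExt (f.D (α + Pi.single i 1)) x‖ₑ ≤
      ENNReal.ofReal ((4 + 2 * (‖w‖ + η) ^ 2) * (‖f.D α‖ + h ^ 2 * S)) := by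
    have key := mul_lintegral_grad_core_le Ω.isOpen w hη h0 h1 hgrad hgrad2 i
    simp_rw [lintegral_enorm_zeroExt] at key
    have e : ∑ j : Fin d, ∑ l : Fin d,
        ENNReal.ofReal ‖f.D (α + Pi.single j 1 + Pi.single l 1)‖ = ENNReal.ofReal S := by
      rw [hSdef, ENNReal.ofReal_sum_of_nonneg fun j _ => Finset.sum_nonneg fun l _ => norm_nonneg _]
      refine Finset.sum_congr rfl fun j _ => ?_
      rw [ENNReal.ofReal_sum_of_nonneg fun l _ => norm_nonneg _]
    have e' {a b c : ℝ} (ha : 0 ≤ a) (hb : 0 ≤ b) (hc : 0 ≤ c) : 4 * ENNReal.ofReal a +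
        2 * ENNReal.ofReal b * ENNReal.ofReal c = ENNReal.ofReal (4 * a + 2 * b * c) := by
      rw [ENNReal.ofReal_add (by positivity) (by positivity), ENNReal.ofReal_mul (by positivity),
        ENNReal.ofReal_mul (by positivity), ENNReal.ofReal_mul (by positivity)]
      simp
    rw [e, e' (norm_nonneg _) (by positivity) hS0] at key
    refine le_trans ?_ (key.trans (ENNReal.ofReal_le_ofReal ?_))
    · gcongr
      exact Set.inter_subset_right
    · have h2 : 0 ≤ (‖w‖ + η) ^ 2 * ‖f.D α‖ := by positivity
      have h3 : 0 ≤ h ^ 2 * S := by positivity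
      nlinarith
  have hsum : ENNReal.ofReal (h * η) * ENNReal.ofReal ‖f.D (α + Pi.single i 1)‖ ≤
      ENNReal.ofReal (C * (‖f.D α‖ + h ^ 2 * S)) := by
    rw [← lintegral_enorm_L1, ← setLIntegral_enorm_zeroExt _ subset_rfl, hC, Finset.sum_mul,
      ENNReal.ofReal_sum_of_nonneg fun w _ => by positivity]
    refine le_trans ?_ (Finset.sum_le_sum fun w _ => hw w)
    rw [← Finset.mul_sum]
    gcongr
    exact setLIntegral_le_sum_inter W (fun w => core Ω (ballCone w η)) hW _
  rw [← ENNReal.ofReal_mul (by positivity), ENNReal.ofReal_le_ofReal_iff] at hsum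
  · rw [div_mul_eq_mul_div, le_div_iff₀ hη]
    linarith
  · have : 0 ≤ C := Finset.sum_nonneg fun w _ => by positivity
    positivity

/-- A sequence that is controlled by its neighbours is controlled by its end points. -/
theorem exists_forall_le_mul_add_of_interpolation {C : ℝ} (hC : 0 ≤ C) (k : ℕ) :
    ∃ K : ℝ, 0 ≤ K ∧ ∀ a : ℕ → ℝ, (∀ j, 0 ≤ a j) →
      (∀ j, j + 2 ≤ k → ∀ h : ℝ, 0 < h → h ≤ 1 →
        h * a (j + 1) ≤ C * (a j + h ^ 2 * a (j + 2))) →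
      ∀ j ≤ k, a j ≤ K * (a 0 + a k) := by
  -- An arbitrary ε is needed for the induction to close: used with the small factor below, the
  -- previous bound lets C a_j be absorbed into half of h a_{j+1}.
  have step : ∀ j, j + 1 ≤ k → ∀ ε : ℝ, 0 < ε → ∃ K : ℝ, 0 ≤ K ∧ ∀ a : ℕ → ℝ, (∀ j, 0 ≤ a j) →
      (∀ j, j + 2 ≤ k → ∀ h : ℝ, 0 < h → h ≤ 1 →
        h * a (j + 1) ≤ C * (a j + h ^ 2 * a (j + 2))) → a j ≤ ε * a (j + 1) + K * a 0 := by
    intro j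
    induction j with
    | zero =>
      intro _ ε hε
      refine ⟨1, zero_le_one, fun a ha _ => ?_⟩
      have := mul_nonneg hε.le (ha 1)
      simp only [zero_add]
      linarith
    | succ j ih =>
      intro hj ε hε
      set h : ℝ := min 1 (ε / (2 * (C + 1))) with hh
      have h0 : 0 < h := lt_min one_pos (by positivity)
      have h1 : h ≤ 1 := min_le_left _ _
      have hhC : 2 * C * h ≤ ε := by
        have : h ≤ ε / (2 * (C + 1)) := min_le_right _ _
        rw [le_div_iff₀ (by positivity)] at this
        nlinarith
      obtain ⟨K, hK0, hK⟩ := ih (by omega) (h / (2 * (C + 1))) (by positivity)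
      refine ⟨2 * C * K / h, by positivity, fun a ha hint => ?_⟩
      have e1 := hint j (by omega) h h0 h1
      have e2 := mul_le_mul_of_nonneg_left (hK a ha hint) hC
      have e3 : C * (h / (2 * (C + 1)) * a (j + 1)) ≤ h / 2 * a (j + 1) := by
        rw [← mul_assoc]
        refine mul_le_mul_of_nonneg_right ?_ (ha _)
        rw [← mul_div_assoc, div_le_div_iff₀ (by positivity) (by norm_num)]
        nlinarith
      have e4 : h / 2 * a (j + 1) ≤ C * (K * a 0) + C * h ^ 2 * a (j + 2) := by
        rw [mul_add] at e1 e2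
        linarith
      have e5 : h * a (j + 1) ≤ h * (ε * a (j + 2) + 2 * C * K / h * a 0) := by
        have : h * (ε * a (j + 2) + 2 * C * K / h * a 0) =
            h * ε * a (j + 2) + 2 * C * K * a 0 := by field_simp
        rw [this]
        have := mul_le_mul_of_nonneg_right (mul_le_mul_of_nonneg_left hhC h0.le) (ha (j + 2))
        linarith
      exact le_of_mul_le_mul_left e5 h0
  -- With ε = 1 the bounds chain downwards from the top order k.
  have down : ∀ i, i ≤ k → ∃ K : ℝ, 0 ≤ K ∧ ∀ a : ℕ → ℝ, (∀ j, 0 ≤ a j) →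
      (∀ j, j + 2 ≤ k → ∀ h : ℝ, 0 < h → h ≤ 1 →
        h * a (j + 1) ≤ C * (a j + h ^ 2 * a (j + 2))) → a (k - i) ≤ K * (a 0 + a k) := by
    intro i
    induction i with
    | zero =>
      intro _
      refine ⟨1, zero_le_one, fun a ha _ => ?_⟩
      have := ha 0
      simp only [Nat.sub_zero]
      linarith
    | succ i ih =>
      intro hi
      obtain ⟨K, hK0, hK⟩ := ih (by omega)
      obtain ⟨K', hK'0, hK'⟩ := step (k - (i + 1)) (by omega) 1 one_pos
      refine ⟨K + K', by positivity, fun a ha hint => ?_⟩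
      have e1 := hK a ha hint
      have e2 := hK' a ha hint
      rw [show k - (i + 1) + 1 = k - i by omega] at e2
      have e3 := mul_nonneg hK'0 (ha k)
      linarith
  choose! K hK0 hK using down
  refine ⟨∑ i ∈ Finset.range (k + 1), K i,
    Finset.sum_nonneg fun i hi => hK0 i (by simpa [Nat.lt_succ_iff] using hi),
    fun a ha hint j hj => ?_⟩
  have e1 := hK (k - j) (by omega) a ha hint
  rw [show k - (k - j) = j by omega] at e1
  refine e1.trans (mul_le_mul_of_nonneg_right ?_ (add_nonneg (ha 0) (ha k)))
  exact Finset.single_le_sum (f := K)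
    (fun i hi => hK0 i (by simpa [Nat.lt_succ_iff] using hi)) (Finset.mem_range.2 (by omega))

/-- The sum of the norms of the derivatives of order `j`. -/
noncomputable def levelNorm (j : ℕ) (f : SobolevSpace Ω k) : ℝ := ∑ α ∈ multiIndexEQ d j, ‖f.D α‖

theorem levelNorm_nonneg (j : ℕ) (f : SobolevSpace Ω k) : 0 ≤ levelNorm j f :=
  Finset.sum_nonneg fun _ _ => norm_nonneg _

theorem norm_D_le_levelNorm (f : SobolevSpace Ω k) {α : Fin d → ℕ} {j : ℕ} (hα : ∑ i, α i = j) :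
    ‖f.D α‖ ≤ levelNorm j f :=
  Finset.single_le_sum (f := fun α => ‖f.D α‖) (fun _ _ => norm_nonneg _) (mem_multiIndexEQ.2 hα)

theorem levelNorm_zero_le (f : SobolevSpace Ω k) : levelNorm 0 f ≤ ‖f.toL1‖ := by
  rw [← SobolevSpace.D_zero_index]
  refine (Finset.sum_le_sum_of_subset_of_nonneg (t := {0}) (fun α hα => ?_)
    fun _ _ _ => norm_nonneg _).trans (by simp)
  rw [mem_multiIndexEQ, Finset.sum_eq_zero_iff] at hα
  simpa [funext_iff] using hα

theorem exists_add_single {α : Fin d → ℕ} {j : ℕ} (hα : ∑ i, α i = j + 1) :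
    ∃ (β : Fin d → ℕ) (i : Fin d), α = β + Pi.single i 1 ∧ ∑ i, β i = j := by
  obtain ⟨i, -, hi⟩ : ∃ i ∈ Finset.univ, α i ≠ 0 := by
    apply Finset.exists_ne_zero_of_sum_ne_zero
    omega
  have e : α = (α - Pi.single i 1) + Pi.single i 1 := by
    ext l
    by_cases hl : l = i
    · subst hl
      simp only [Pi.add_apply, Pi.sub_apply, Pi.single_eq_same]
      omega
    · simp [Pi.single_eq_of_ne hl]
  refine ⟨_, i, e, ?_⟩
  rw [e, sum_add_single] at hα
  omega

/-- Each index of order j + 1 is β + e_i with |β| = j, so the interpolation inequality, summed over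
indices, becomes the three-term scalar inequality. The number of indices and the double sum over
second derivatives only enlarge the constant, independently of h. -/
theorem exists_levelNorm_le (hcone : ConeCondition (Ω : Set (EuclideanSpace ℝ (Fin d)))) :
    ∃ K : ℝ, 0 ≤ K ∧ ∀ f : SobolevSpace Ω k, ∀ j ≤ k,
      levelNorm j f ≤ K * (levelNorm 0 f + levelNorm k f) := by
  obtain ⟨C, hC0, hC⟩ := exists_mul_norm_D_le (k := k) hcone
  set N : ℝ := (multiIndexLE d k).card * (C * (1 + (d : ℝ) ^ 2)) with hN
  obtain ⟨K, hK0, hK⟩ := exists_forall_le_mul_add_of_interpolation (C := N) (by positivity) k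
  refine ⟨K, hK0, fun f j hj => hK (fun j => levelNorm j f) (fun j => levelNorm_nonneg j f) ?_ j hj⟩
  intro j hj h h0 h1
  have hb0 := levelNorm_nonneg j f
  have hb2 := levelNorm_nonneg (j + 2) f
  have hα : ∀ α ∈ multiIndexEQ d (j + 1), h * ‖f.D α‖ ≤
      C * (1 + (d : ℝ) ^ 2) * (levelNorm j f + h ^ 2 * levelNorm (j + 2) f) := by
    intro α hα
    obtain ⟨β, i, rfl, hβ⟩ := exists_add_single (mem_multiIndexEQ.1 hα)
    refine (hC f β (by omega) i h h0 h1).trans ?_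
    have e1 : ∑ j, ∑ l, ‖f.D (β + Pi.single j 1 + Pi.single l 1)‖ ≤
        (d : ℝ) ^ 2 * levelNorm (j + 2) f := by
      have : ∀ i ∈ Finset.univ, ∑ l, ‖f.D (β + Pi.single i 1 + Pi.single l 1)‖ ≤
          d * levelNorm (j + 2) f := by
        intro i _
        have := Finset.sum_le_card_nsmul (Finset.univ : Finset (Fin d))
          (fun l => ‖f.D (β + Pi.single i 1 + Pi.single l 1)‖) (levelNorm (j + 2) f)
          fun l _ => norm_D_le_levelNorm f (by rw [sum_add_single, sum_add_single, hβ])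
        simpa using this
      refine (Finset.sum_le_card_nsmul _ _ _ this).trans (le_of_eq ?_)
      simp
      ring
    have e2 := norm_D_le_levelNorm f hβ
    rw [mul_assoc]
    refine mul_le_mul_of_nonneg_left ?_ hC0
    have e3 := mul_le_mul_of_nonneg_left e1 (sq_nonneg h)
    have e4 : 0 ≤ (d : ℝ) ^ 2 * levelNorm j f := by positivity
    have e5 : 0 ≤ h ^ 2 * levelNorm (j + 2) f := by positivity
    nlinarith
  have hsum := Finset.sum_le_card_nsmul _ _ _ hα
  rw [← Finset.mul_sum, nsmul_eq_mul] at hsum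
  refine hsum.trans ?_
  have hcard : ((multiIndexEQ d (j + 1)).card : ℝ) ≤ (multiIndexLE d k).card := by
    refine Nat.cast_le.2 (Finset.card_le_card fun α hα => ?_)
    rw [mem_multiIndexEQ] at hα
    rw [mem_multiIndexLE]
    omega
  refine (mul_le_mul_of_nonneg_right hcard (by positivity)).trans (le_of_eq ?_)
  rw [hN]
  ring

theorem exists_norm_le_levelNorm (hcone : ConeCondition (Ω : Set (EuclideanSpace ℝ (Fin d)))) :
    ∃ K : ℝ, 0 ≤ K ∧ ∀ f : SobolevSpace Ω k,
      ‖f‖ ≤ K * (‖f.toL1‖ + ∑ α ∈ multiIndexEQ d k, ‖f.D α‖) := by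
  obtain ⟨K, hK0, hK⟩ := exists_levelNorm_le (k := k) hcone
  refine ⟨(multiIndexLE d k).card * K, by positivity, fun f => ?_⟩
  rw [SobolevSpace.norm_def, mul_assoc, ← nsmul_eq_mul]
  refine Finset.sum_le_card_nsmul _ _ _ fun α hα => ?_
  refine (norm_D_le_levelNorm f rfl).trans ((hK f _ (mem_multiIndexLE.1 hα)).trans ?_)
  refine mul_le_mul_of_nonneg_left ?_ hK0
  exact add_le_add (levelNorm_zero_le f) le_rfl

end Sobolev

/-! ### Operators and the bidual -/

section BidualMap

variable {X Y : Type*} [NormedAddCommGroup X] [NormedSpace ℝ X] [NormedAddCommGroup Y]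
  [NormedSpace ℝ Y]

/-- The bitranspose of T is weak-star continuous, so it carries ξ into the closure of the image
family, which by assumption consists of elements of Y. -/
theorem exists_forall_comp_eq_of_mem_closure (T : X →L[ℝ] Y) {S : Set X}
    (hS : closure (NormedSpace.inclusionInDoubleDualWeak ℝ Y '' (toWeakSpace ℝ Y '' (T '' S))) ⊆
      Set.range (NormedSpace.inclusionInDoubleDualWeak ℝ Y))
    {ξ : WeakDual ℝ (StrongDual ℝ X)}
    (hξ : ξ ∈ closure (NormedSpace.inclusionInDoubleDualWeak ℝ X '' (toWeakSpace ℝ X '' S))) :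
    ∃ y : Y, ∀ l : StrongDual ℝ Y, ξ (l.comp T) = l y := by
  let P : StrongDual ℝ Y →L[ℝ] StrongDual ℝ X := (ContinuousLinearMap.compL ℝ X Y ℝ).flip T
  let Φ : WeakDual ℝ (StrongDual ℝ X) → WeakDual ℝ (StrongDual ℝ Y) := fun ζ =>
    StrongDual.toWeakDual ((WeakDual.toStrongDual ζ).comp P)
  have hΦ : Continuous Φ :=
    WeakDual.continuous_of_continuous_eval fun l => WeakDual.eval_continuous (P l)
  have h1 : Φ ξ ∈ closure (Φ '' (NormedSpace.inclusionInDoubleDualWeak ℝ X ''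
      (toWeakSpace ℝ X '' S))) := image_closure_subset_closure_image hΦ ⟨ξ, hξ, rfl⟩
  have h2 : Φ '' (NormedSpace.inclusionInDoubleDualWeak ℝ X '' (toWeakSpace ℝ X '' S)) ⊆
      NormedSpace.inclusionInDoubleDualWeak ℝ Y '' (toWeakSpace ℝ Y '' (T '' S)) := by
    rintro _ ⟨_, ⟨_, ⟨f, hf, rfl⟩, rfl⟩, rfl⟩
    exact ⟨_, ⟨_, ⟨f, hf, rfl⟩, rfl⟩, rfl⟩
  obtain ⟨y, hy⟩ := hS (closure_mono h2 h1)
  refine ⟨(toWeakSpace ℝ Y).symm y, fun l => ?_⟩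
  have := congrArg (fun ζ => ζ l) hy
  exact this.symm

/-- Functionals factor through bounded-below operators. -/
theorem exists_extension_of_norm_le (T : X →L[ℝ] Y) {C : ℝ} (hT : ∀ x, ‖x‖ ≤ C * ‖T x‖)
    (l : StrongDual ℝ X) : ∃ ψ : StrongDual ℝ Y, ψ.comp T = l := by
  have hinj : Function.Injective T.toLinearMap := by
    rw [injective_iff_map_eq_zero]
    intro x hx
    have := hT x
    rw [show T x = 0 from hx, norm_zero, mul_zero] at this
    exact norm_le_zero_iff.1 this
  let e := LinearEquiv.ofInjective T.toLinearMap hinj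
  have he (y : LinearMap.range T.toLinearMap) : T (e.symm y) = y := by
    have := e.apply_symm_apply y
    exact congrArg Subtype.val this
  let f : StrongDual ℝ (LinearMap.range T.toLinearMap) :=
    LinearMap.mkContinuous (l.toLinearMap ∘ₗ e.symm.toLinearMap) (‖l‖ * C) (by
      intro y
      refine (l.le_opNorm _).trans ?_
      rw [mul_assoc]
      refine mul_le_mul_of_nonneg_left ((hT _).trans (le_of_eq ?_)) (norm_nonneg _)
      change C * ‖T (e.symm y)‖ = _
      rw [he]
      rfl)
  obtain ⟨ψ, hψ, -⟩ := exists_extension_norm_eq _ f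
  refine ⟨ψ, ?_⟩
  ext x
  have h1 := hψ (e x)
  have h2 : f (e x) = l x := by
    change l (e.symm (e x)) = l x
    rw [e.symm_apply_apply]
  rw [← h2, ← h1]
  rfl

end BidualMap

/-! ### Transfer to the Sobolev space -/

namespace Sobolev

variable {d : ℕ} {Ω : Opens (EuclideanSpace ℝ (Fin d))} {k : ℕ}

/-- The weak derivative as a continuous linear map from `W^{k,1}(Ω)` to `L¹(Ω)`. -/
noncomputable def derivCLM (Ω : Opens (EuclideanSpace ℝ (Fin d))) {α : Fin d → ℕ}
    (hα : ∑ i, α i ≤ k) : SobolevSpace Ω k →L[ℝ] L1 Ω :=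
  LinearMap.mkContinuous
    { toFun := SobolevSpace.D α
      map_add' := SobolevSpace.D_add hα
      map_smul' := SobolevSpace.D_smul hα } 1 fun f => by
        rw [one_mul]
        exact norm_D_le f hα

theorem derivCLM_apply {α : Fin d → ℕ} (hα : ∑ i, α i ≤ k) (f : SobolevSpace Ω k) :
    derivCLM Ω hα f = f.D α := rfl

theorem exists_functional_of_test {φ : EuclideanSpace ℝ (Fin d) → ℝ}
    (h : ContDiff ℝ ∞ φ ∧ HasCompactSupport φ) : ∃ l : StrongDual ℝ (L1 Ω), ∀ g : L1 Ω,
      l g = ∫ x in (Ω : Set (EuclideanSpace ℝ (Fin d))), g x * φ x := by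
  obtain ⟨C, hC⟩ := h.1.continuous.bounded_above_of_compact_support h.2
  exact ⟨integralMulCLM φ h.1.continuous.aestronglyMeasurable (Eventually.of_forall hC),
    fun g => rfl⟩

/-- The collection of all derivatives embeds W^{k,1} into a finite product of copies of L¹ and is
bounded below. Hahn–Banach extends the functional to the product, where it splits into components.
-/
theorem exists_sum_comp_derivCLM (l : StrongDual ℝ (SobolevSpace Ω k)) :
    ∃ ψ : multiIndexLE d k → StrongDual ℝ (L1 Ω),
      l = ∑ α, (ψ α).comp (derivCLM Ω (mem_multiIndexLE.1 α.2)) := by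
  classical
  let T : SobolevSpace Ω k →L[ℝ] (multiIndexLE d k → L1 Ω) :=
    ContinuousLinearMap.pi fun α => derivCLM Ω (mem_multiIndexLE.1 α.2)
  obtain ⟨ψ, hψ⟩ := exists_extension_of_norm_le T (C := (multiIndexLE d k).card) (by
    intro f
    rw [SobolevSpace.norm_def, ← nsmul_eq_mul]
    exact Finset.sum_le_card_nsmul _ _ _ fun α hα => norm_le_pi_norm (T f) ⟨α, hα⟩) l
  refine ⟨fun α => ψ.comp (ContinuousLinearMap.single ℝ (fun _ => L1 Ω) α), ?_⟩
  rw [← hψ]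
  ext f
  rw [sum_apply]
  change ψ (T f) = ∑ α, ψ (Pi.single α (T f α))
  rw [← map_sum, Finset.univ_sum_single]

/-- The bitransposes of the derivative maps send ξ to functions g_α in L¹. The identity defining a
weak derivative equates two functionals on W^{k,1}; evaluating ξ on it shows that g_α = D^α g_0. So
g_0 lies in W^{k,1}, and it represents ξ because functionals decompose along the derivatives. -/
theorem closure_subset_range_of_derivs {F : Set (SobolevSpace Ω k)}
    (h : ∀ (α : Fin d → ℕ) (hα : ∑ i, α i ≤ k),
      closure (NormedSpace.inclusionInDoubleDualWeak ℝ (L1 Ω) ''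
        (toWeakSpace ℝ (L1 Ω) '' (derivCLM Ω hα '' F))) ⊆
      Set.range (NormedSpace.inclusionInDoubleDualWeak ℝ (L1 Ω))) :
    closure (NormedSpace.inclusionInDoubleDualWeak ℝ (SobolevSpace Ω k) ''
      (toWeakSpace ℝ (SobolevSpace Ω k) '' F)) ⊆
      Set.range (NormedSpace.inclusionInDoubleDualWeak ℝ (SobolevSpace Ω k)) := by
  intro ξ hξ
  choose g hg using fun (α : Fin d → ℕ) (hα : ∑ i, α i ≤ k) =>
    exists_forall_comp_eq_of_mem_closure (derivCLM Ω hα) (h α hα) hξ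
  have h0 : ∑ i, (0 : Fin d → ℕ) i ≤ k := by simp
  have hweak (α : Fin d → ℕ) (hα : ∑ i, α i ≤ k) : IsWeakDeriv Ω α (g 0 h0) (g α hα) := by
    intro φ h1 h2 h3
    obtain ⟨l, hl⟩ := exists_functional_of_test (Ω := Ω) ⟨h1, h2⟩
    obtain ⟨l', hl'⟩ := exists_functional_of_test (Ω := Ω) (mderiv_smooth α ⟨h1, h2⟩)
    have e : l'.comp (derivCLM Ω h0) = (-1 : ℝ) ^ (∑ i, α i) • l.comp (derivCLM Ω hα) := by
      ext f
      change l' (f.D 0) = (-1 : ℝ) ^ (∑ i, α i) * l (f.D α)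
      rw [hl', hl, SobolevSpace.D_zero_index]
      exact SobolevSpace.isWeakDeriv_D hα f φ h1 h2 h3
    have e2 := hg 0 h0 l'
    rw [e, map_smul, hg α hα l, hl, hl', smul_eq_mul] at e2
    exact e2.symm
  let x : SobolevSpace Ω k := ⟨g 0 h0, fun α hα => ⟨_, hweak α hα⟩⟩
  have hx (α : Fin d → ℕ) (hα : ∑ i, α i ≤ k) : x.D α = g α hα := (hweak α hα).weakDeriv_eq
  refine ⟨toWeakSpace ℝ _ x, ?_⟩
  apply DFunLike.ext
  intro l
  change l x = ξ l
  obtain ⟨ψ, rfl⟩ := exists_sum_comp_derivCLM l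
  rw [map_sum, sum_apply]
  refine Finset.sum_congr rfl fun α _ => ?_
  rw [hg, ContinuousLinearMap.comp_apply, derivCLM_apply, hx]

theorem equiIntegrableOn_of_forall {I : Finset (Fin d → ℕ)} {F : Set (SobolevSpace Ω k)}
    (h : ∀ α ∈ I, ∀ ε > 0, ∃ δ > 0, ∀ f ∈ F, ∀ A : Set (EuclideanSpace ℝ (Fin d)), A ⊆ Ω →
      NullMeasurableSet A volume → volume A < ENNReal.ofReal δ → ∫ x in A, |f.D α x| ≤ ε) :
    EquiIntegrableOn I F := by
  have key : ∀ ε > 0, ∃ δ > 0, ∀ f ∈ F, ∀ A : Set (EuclideanSpace ℝ (Fin d)), A ⊆ Ω →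
      NullMeasurableSet A volume → volume A < ENNReal.ofReal δ →
      ∑ α ∈ I, ∫ x in A, |f.D α x| < ε := by
    intro ε hε
    have hev : ∀ᶠ δ in 𝓝[>] (0 : ℝ), ∀ α ∈ I, ∀ f ∈ F, ∀ A : Set (EuclideanSpace ℝ (Fin d)),
        A ⊆ Ω → NullMeasurableSet A volume → volume A < ENNReal.ofReal δ →
        -- The added 1 covers an empty index set and makes the summed inequality strict.
        ∫ x in A, |f.D α x| ≤ ε / (I.card + 1) := by
      rw [Filter.eventually_all_finset]
      intro α hα
      obtain ⟨δ, hδ, hδF⟩ := h α hα (ε / (I.card + 1)) (by positivity)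
      filter_upwards [Ioc_mem_nhdsGT hδ] with δ' hδ' f hf A hA hAm hAδ
      exact hδF f hf A hA hAm (hAδ.trans_le (ENNReal.ofReal_le_ofReal hδ'.2))
    obtain ⟨δ, hδ, hδ0⟩ := (hev.and self_mem_nhdsWithin).exists
    refine ⟨δ, hδ0, fun f hf A hA hAm hAδ => ?_⟩
    refine (Finset.sum_le_card_nsmul _ _ _ fun α hα => hδ α hα f hf A hA hAm hAδ).trans_lt ?_
    rw [nsmul_eq_mul, ← mul_div_assoc, div_lt_iff₀ (by positivity)]
    linarith
  choose! δ hδ hδF using key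
  exact ⟨δ, hδ, fun f hf ε hε A => hδF ε hε f hf A⟩

theorem EquiIntegrableOn.exists_forall_le {I : Finset (Fin d → ℕ)} {F : Set (SobolevSpace Ω k)}
    (h : EquiIntegrableOn I F) {α : Fin d → ℕ} (hα : α ∈ I) {ε : ℝ} (hε : 0 < ε) :
    ∃ δ > 0, ∀ f ∈ F, ∀ A : Set (EuclideanSpace ℝ (Fin d)), A ⊆ Ω →
      NullMeasurableSet A volume → volume A < ENNReal.ofReal δ → ∫ x in A, |f.D α x| ≤ ε := by
  obtain ⟨δ, hδ, hF⟩ := h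
  refine ⟨δ ε, hδ ε hε, fun f hf A hA hAm hAδ => le_trans ?_ (hF f hf ε hε A hA hAm hAδ).le⟩
  exact Finset.single_le_sum (f := fun α => ∫ x in A, |f.D α x|)
    (fun _ _ => integral_nonneg fun _ => abs_nonneg _) hα

theorem multiIndexEQ_subset : multiIndexEQ d k ⊆ multiIndexLE d k := Finset.filter_subset _ _

theorem boundedFamily_iff_boundedZeroTop
    (hcone : ConeCondition (Ω : Set (EuclideanSpace ℝ (Fin d)))) (F : Set (SobolevSpace Ω k)) :
    BoundedFamily F ↔ BoundedZeroTop F := by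
  constructor
  · rintro ⟨M, hM, hF⟩
    refine ⟨2 * M, by positivity, fun f hf => ?_⟩
    have h1 : ‖f.toL1‖ ≤ ‖f‖ := by
      rw [← SobolevSpace.D_zero_index]
      exact norm_D_le f (by simp)
    have h2 : ∑ α ∈ multiIndexEQ d k, ‖f.D α‖ ≤ ‖f‖ := by
      rw [SobolevSpace.norm_def]
      exact Finset.sum_le_sum_of_subset_of_nonneg multiIndexEQ_subset fun _ _ _ => norm_nonneg _
    linarith [hF f hf]
  · rintro ⟨M, hM, hF⟩
    obtain ⟨K, hK0, hK⟩ := exists_norm_le_levelNorm (k := k) hcone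
    refine ⟨(K + 1) * M, by positivity, fun f hf => (hK f).trans ?_⟩
    have := mul_le_mul_of_nonneg_left (hF f hf) hK0
    linarith

/-- Orders below k need only the bound on the family and the cone condition; the hypothesis on the
top order is used for |α| = k alone. -/
theorem equiIntegrable_iff_equiIntegrableTop
    (hcone : ConeCondition (Ω : Set (EuclideanSpace ℝ (Fin d)))) {F : Set (SobolevSpace Ω k)}
    (hF : BoundedFamily F) : EquiIntegrable F ↔ EquiIntegrableTop F := by
  constructor
  · exact fun h => equiIntegrableOn_of_forall fun α hα ε hε =>
      h.exists_forall_le (multiIndexEQ_subset hα) hε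
  · intro h
    refine equiIntegrableOn_of_forall fun α hα ε hε => ?_
    by_cases hk : ∑ i, α i = k
    · exact h.exists_forall_le (mem_multiIndexEQ.2 hk) hε
    · obtain ⟨M, hM, hFM⟩ := hF
      obtain ⟨δ, hδ, hδF⟩ := exists_forall_setLIntegral_D_le (k := k) hcone hM hε
      have hα' := mem_multiIndexLE.1 hα
      refine ⟨δ, hδ, fun f hf A hA _ hAδ => ?_⟩
      have := hδF f (hFM f hf) α (by omega) A hA hAδ
      have hi : IntegrableOn (f.D α) A :=
        IntegrableOn.mono_set (L1.integrable_coeFn (f.D α)) hA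
      rw [← ofReal_integral_norm_eq_lintegral_enorm hi, ENNReal.ofReal_le_ofReal_iff hε.le] at this
      exact this

theorem equiIntegrableAtInfinity_of_isBounded
    (hbdd : Bornology.IsBounded (Ω : Set (EuclideanSpace ℝ (Fin d))))
    (F : Set (SobolevSpace Ω k)) : EquiIntegrableAtInfinity F :=
  ⟨fun _ => Ω, fun _ _ => ⟨subset_rfl, Ω.isOpen.measurableSet.nullMeasurableSet,
    hbdd.measure_lt_top⟩, fun f _ ε hε => by simpa using hε⟩

theorem isFiniteMeasure_restrict
    (hbdd : Bornology.IsBounded (Ω : Set (EuclideanSpace ℝ (Fin d)))) :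
    IsFiniteMeasure (volume.restrict (Ω : Set (EuclideanSpace ℝ (Fin d)))) :=
  ⟨by simpa using hbdd.measure_lt_top⟩

theorem relativelyWeaklyCompact_of_equiIntegrable
    (hbdd : Bornology.IsBounded (Ω : Set (EuclideanSpace ℝ (Fin d)))) {F : Set (SobolevSpace Ω k)}
    (hF : BoundedFamily F) (h : EquiIntegrable F) : RelativelyWeaklyCompact F := by
  have := isFiniteMeasure_restrict hbdd
  obtain ⟨M, hM, hFM⟩ := hF
  refine NormedSpace.isCompact_closure_of_isBounded ℝ (SobolevSpace Ω k) _ ?_ ?_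
  · rw [Set.preimage_image_eq _ (toWeakSpace ℝ (SobolevSpace Ω k)).injective]
    exact isBounded_iff_forall_norm_le.2 ⟨M, hFM⟩
  · refine closure_subset_range_of_derivs fun α hα => ?_
    refine closure_image_inclusionInDoubleDualWeak_subset_range
      (exists_isCompact_approx_of_equiIntegrable hM ?_ ?_)
    · rintro _ ⟨f, hf, rfl⟩
      exact (norm_D_le f hα).trans (hFM f hf)
    · intro ε hε
      obtain ⟨δ, hδ, hδF⟩ := h.exists_forall_le (mem_multiIndexLE.2 hα) hε
      refine ⟨δ, hδ, ?_⟩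
      rintro _ ⟨f, hf, rfl⟩ A hA hAδ
      rw [Measure.restrict_apply hA] at hAδ
      rw [Measure.restrict_restrict hA]
      exact hδF f hf _ Set.inter_subset_right
        (hA.inter Ω.isOpen.measurableSet).nullMeasurableSet hAδ

theorem RelativelyWeaklyCompact.boundedFamily {F : Set (SobolevSpace Ω k)}
    (h : RelativelyWeaklyCompact F) : BoundedFamily F := by
  obtain ⟨M, hM, hF⟩ := exists_norm_le_of_isCompact_toWeakSpace h
  exact ⟨M, hM, fun f hf => hF f (subset_closure ⟨f, hf, rfl⟩)⟩

/-- Bounded operators are weakly continuous, so each D^α maps the weakly compact closure to a weakly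
compact subset of L¹, where the Dunford–Pettis criterion applies. -/
theorem RelativelyWeaklyCompact.equiIntegrable
    (hbdd : Bornology.IsBounded (Ω : Set (EuclideanSpace ℝ (Fin d)))) {F : Set (SobolevSpace Ω k)}
    (h : RelativelyWeaklyCompact F) : EquiIntegrable F := by
  have := isFiniteMeasure_restrict hbdd
  -- Makes the separability of L¹ available to instance search.
  have : Fact ((1 : ENNReal) ≠ ⊤) := ⟨ENNReal.one_ne_top⟩
  refine equiIntegrableOn_of_forall fun α hα ε hε => ?_
  have hα := mem_multiIndexLE.1 hα
  obtain ⟨δ, hδ, hK⟩ := equiIntegrable_of_isCompact_toWeakSpace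
    (IsCompact.image h (WeakSpace.map (derivCLM Ω hα)).continuous) hε
  refine ⟨δ, hδ, fun f hf A hA hAm hAδ => ?_⟩
  -- A is only null measurable, so it is replaced by a measurable set that agrees with it almost
  -- everywhere.
  obtain ⟨t, -, ht, htA⟩ := hAm.exists_measurable_superset_ae_eq
  have hae : (t ∩ Ω : Set (EuclideanSpace ℝ (Fin d))) =ᵐ[volume] A := by
    have := htA.inter (EventuallyEq.refl (ae volume) (Ω : Set (EuclideanSpace ℝ (Fin d))))
    rwa [Set.inter_eq_self_of_subset_left hA] at this
  have := hK (f.D α) ⟨_, subset_closure ⟨f, hf, rfl⟩, rfl⟩ t ht (by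
    rwa [Measure.restrict_apply ht, measure_congr hae])
  rwa [Measure.restrict_restrict ht, setIntegral_congr_set hae] at this

end Sobolev

end

theorem theorem1p3 {d : ℕ} (hd : 1 ≤ d) (k : ℕ)
    (Ω : TopologicalSpace.Opens (EuclideanSpace ℝ (Fin d)))
    (hbdd : Bornology.IsBounded (Ω : Set (EuclideanSpace ℝ (Fin d))))
    (hcone : Sobolev.ConeCondition (Ω : Set (EuclideanSpace ℝ (Fin d))))
    (F : Set (Sobolev.SobolevSpace Ω k)) :
    (Sobolev.BoundedFamily F ↔ Sobolev.BoundedZeroTop F) ∧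
    (Sobolev.BoundedFamily F → (Sobolev.EquiIntegrable F ↔ Sobolev.EquiIntegrableTop F)) ∧
    (Sobolev.BoundedFamily F ∧ Sobolev.EquiIntegrableTop F ∧ Sobolev.EquiIntegrableAtInfinity F ↔
      Sobolev.RelativelyWeaklyCompact F) := by
  have hiff := Sobolev.boundedFamily_iff_boundedZeroTop hcone F
  refine ⟨hiff, Sobolev.equiIntegrable_iff_equiIntegrableTop hcone, ?_, fun h => ?_⟩
  · rintro ⟨hB, hE, -⟩
    exact Sobolev.relativelyWeaklyCompact_of_equiIntegrable hbdd hB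
      ((Sobolev.equiIntegrable_iff_equiIntegrableTop hcone hB).2 hE)
  · have hB := h.boundedFamily
    exact ⟨hB, (Sobolev.equiIntegrable_iff_equiIntegrableTop hcone hB).1 (h.equiIntegrable hbdd),
      Sobolev.equiIntegrableAtInfinity_of_isBounded hbdd F⟩
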